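/- Let $T>0$, $\alpha\in(\tfrac13,\tfrac12]$, let $V,K$ be separable real Banach spaces, and let $\beta=(\beta_0,\dots,\beta_3)$ with $\beta_k\ge 0$. Let $E=\mathcal C^{\beta}(V;V)$ be the space of three times continuously differentiable $\phi:V\to V$ with $$\|\phi\|=\sum_{k=0}^{3}\sup_{x\in V}\frac{\|D^k\phi(x)\|}{(1+\|x\|)^{\beta_k}}<\infty .$$ Tensor products $\otimes$ of normed spaces are completed projective tensor products; a bounded bilinear map $B$ on $E_1\times E_2$ with values in a Banach space is identified with a bounded linear operator on $E_1\otimes E_2$, $B(x\otimes y)=B(x,y)$; and ${}^*$ is the transpose, $(x\otimes y)^*=y\otimes x$. For a path write $\Phi_{s,t}=\Phi_t-\Phi_s$. A path $\Phi$ (a two-parameter function $\Psi$) on $[0,T]$ is $\gamma$-Hölder if $\|\Phi_{s,t}\|\le C|t-s|^\gamma$ (resp. $\|\Psi_{s,t}\|\le C|t-s|^\gamma$) for some $C$ and all $s\ne t$ in $[0,T]$. Let $\mathbf W=(W,\mathcal W)$ be an $E$-valued $\alpha$-Hölder rough path: $W:[0,T]\to E$ is $\alpha$-Hölder, $\mathcal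 W:[0,T]^2\to E\otimes E$ is $2\alpha$-Hölder, and $\mathcal W_{s,t}-\mathcal W_{s,u}-\mathcal W_{u,t}=W_{s,u}\otimes W_{u,t}$ for all $s,u,t\in[0,T]$. For a Banach space $B$, a pair $(P,P')$ of $\alpha$-Hölder paths, $P$ in $B$ and $P'$ in $\mathcal L(E;B)$, is *controlled by $W$*, written $(P,P')\in\mathscr D^{2\alpha}_W(B)$, if $(s,t)\mapsto P_{s,t}-P'_sW_{s,t}$ is $2\alpha$-Hölder. Let $(Y,Y')\in\mathscr D^{2\alpha}_W(V)$ and $(Z,Z')\in\mathscr D^{2\alpha}_W(\mathcal L(V;K))$. All integrals from $s$ to $t$, $s\le t$, are limits $\lim_{|\pi|\to0}\sum_k\Xi_{t_{k-1},t_k}$ over partitions $\pi=(s=t_0<\dots<t_n=t)$ (for $t<s$ put $\int_s^t=-\int_t^s$), with the following $\Xi_{u,v}$: * $\int Q\,dP$: $\;Q_uP_{u,v}+(Q'_uP'_u)\mathcal W_{u,v}$, and $\int dQ\,(P)$: $\;Q_{u,v}P_u+(Q'_uP'_u)\mathcal W^{*}_{u,v}$, for controlled $P,Q$ with $Q$ operator-valued,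 where $(Q'_uP'_u)(\phi_1\otimes\phi_2)=Q'_u(\phi_1)[P'_u(\phi_2)]$; * $\int Q\otimes dP$: $\;Q_u\otimes P_{u,v}+(Q'_u\otimes P'_u)\mathcal W_{u,v}$; * $G_t=\int_0^tW(dr,Y_r)$: $\;W_{u,v}(Y_u)+B_u\mathcal W_{u,v}$, $\;B_u(\phi_1\otimes\phi_2)=D\phi_2(Y_u)[Y'_u\phi_1]$; * $X_t=\int_0^tDW(dr,Y_r)\in\mathcal L(V;V)$: $\;DW_{u,v}(Y_u)+\widetilde B_u\mathcal W_{u,v}$, $\;\widetilde B_u(\phi_1\otimes\phi_2)=D^2\phi_2(Y_u)[Y'_u\phi_1]$; * $\int A\,d\Psi$ (Young integral against a two-parameter function $\Psi$): $\;A_u\Psi_{u,v}$. Put $F_t=W(t,Y_t)$, $H_t=Z_t\,DW(t,Y_t)\in\mathcal L(V;K)$, and, for all $s,t\in[0,T]$, $$\langle Y\rangle_{s,t}=Y_{s,t}\otimes Y_{s,t}-2\int_s^tY_{s,r}\otimes dY_r,$$ $$\langle\!\langle X,Y\rangle\!\rangle _{s,t}=X_{s,t}Y_{s,t}-2\int_s^tX_{s,r}\,dY_r,\qquad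 \langle\!\langle Y,X\rangle\!\rangle _{s,t}=X_{s,t}Y_{s,t}-2\int_s^tdX_r\,(Y_{s,r}).$$ Then the integrals defining $G$, $X$, $\langle Y\rangle$, $\langle\!\langle X,Y\rangle\!\rangle $ and $\langle\!\langle Y,X\rangle\!\rangle $ exist; $F,G,X,H$ are controlled by $W$ with Gubinelli derivatives $$F'_t\phi=\phi(Y_t)+DW(t,Y_t)Y'_t\phi,\quad G'_t\phi=\phi(Y_t),\quad X'_t\phi=D\phi(Y_t),$$ $$H'_t\phi=Z'_t(\phi)\,DW(t,Y_t)+Z_t\,D\phi(Y_t)+Z_t\,D^2W(t,Y_t)(Y'_t\phi);$$ $\langle Y\rangle$, $\langle\!\langle X,Y\rangle\!\rangle $ and $\langle\!\langle Y,X\rangle\!\rangle $ are $2\alpha$-Hölder; and for all $0\le s\le t\le T$ all the integrals in the following Itô-type formula exist and $$\int_s^tZ_r\,dW(r,Y_r)=\int_s^tZ_r\,W(dr,Y_r)+\int_s^tZ_r\,DW(r,Y_r)\,dY_r+\frac12\Big[\int_s^tZ_r\,D^2W(r,Y_r)\,d\langle Y\rangle_r+\int_s^tZ_r\,d\big(\langle\!\langle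 X,Y\rangle\!\rangle +\langle\!\langle Y,X\rangle\!\rangle \big)_r\Big],$$ where the first three integrals are $\int Z\,dF$, $\int Z\,dG$ and $\int H\,dY$, and $Z_rD^2W(r,Y_r)$ is the operator $x\otimes y\mapsto Z_r[D^2W(r,Y_r)(x,y)]$ on $V\otimes V$. Moreover $\int_s^tZ_r\,d\langle\!\langle X,Y\rangle\!\rangle _r$ exists if and only if $\int_s^tZ_r\,d\langle\!\langle Y,X\rangle\!\rangle _r$ exists, and in that case the last integral is the sum of these two, that is, $$\int_s^tZ_r\,dW(r,Y_r)=\int_s^tZ_r\,W(dr,Y_r)+\int_s^tZ_r\,DW(r,Y_r)\,dY_r+\frac12\Big[\int_s^tZ_r\,D^2W(r,Y_r)\,d\langle Y\rangle_r+\int_s^tZ_r\,d\langle\!\langle X,Y\rangle\!\rangle _r+\int_s^tZ_r\,d\langle\!\langle Y,X\rangle\!\rangle _r\Big].$$ -/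

import Mathlib

noncomputable section

namespace RoughIto

/-! ### Completed projective tensor product of two normed spaces -/

section Tensor

set_option linter.unusedSectionVars false

open scoped TensorProduct

/-- The algebraic tensor product, as a type synonym that will carry the projective norm. -/
def AlgTensor (E F : Type*) [NormedAddCommGroup E] [NormedSpace ℝ E]
    [NormedAddCommGroup F] [NormedSpace ℝ F] : Type _ := E ⊗[ℝ] F

variable {E F G : Type*} [NormedAddCommGroup E] [NormedSpace ℝ E]
  [NormedAddCommGroup F] [NormedSpace ℝ F] [NormedAddCommGroup G] [NormedSpace ℝ G]

instance : AddCommGroup (AlgTensor E F) := inferInstanceAs (AddCommGroup (E ⊗[ℝ] F))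

instance : Module ℝ (AlgTensor E F) := inferInstanceAs (Module ℝ (E ⊗[ℝ] F))

/-- The bilinear map `(x, y) ↦ x ⊗ y` into the algebraic tensor product. -/
def atmul : E →ₗ[ℝ] F →ₗ[ℝ] AlgTensor E F := TensorProduct.mk ℝ E F

/-- The linear map on the algebraic tensor product with `x ⊗ y ↦ B x y`. -/
def algLiftLin (B : E →L[ℝ] F →L[ℝ] G) : AlgTensor E F →ₗ[ℝ] G :=
  TensorProduct.lift (B.toLinearMap₁₂)

theorem algLiftLin_atmul (B : E →L[ℝ] F →L[ℝ] G) (x : E) (y : F) :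
    algLiftLin B (atmul x y) = B x y :=
  TensorProduct.lift.tmul x y

/-- `∑ xᵢ ⊗ yᵢ` for a finite list of pairs `(xᵢ, yᵢ)`. -/
def tensorSum (l : List (E × F)) : AlgTensor E F :=
  (l.map fun p => (atmul p.1 p.2 : AlgTensor E F)).sum

/-- `∑ ‖xᵢ‖ ‖yᵢ‖` for a finite list of pairs `(xᵢ, yᵢ)`. -/
def tensorCost (l : List (E × F)) : ℝ := (l.map fun p => ‖p.1‖ * ‖p.2‖).sum

/-- The projective norm: the infimum of `∑ ‖xᵢ‖ ‖yᵢ‖` over all representations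
`z = ∑ xᵢ ⊗ yᵢ`. -/
def projNorm (z : AlgTensor E F) : ℝ := sInf (tensorCost '' {l : List (E × F) | tensorSum l = z})

instance : Norm (AlgTensor E F) := ⟨projNorm⟩

theorem tensorCost_nonneg (l : List (E × F)) : 0 ≤ tensorCost l := by
  unfold tensorCost
  apply List.sum_nonneg
  intro a ha
  obtain ⟨p, -, rfl⟩ := List.mem_map.1 ha
  positivity

theorem tensorSum_append (l m : List (E × F)) :
    tensorSum (l ++ m) = tensorSum l + tensorSum m := by
  simp [tensorSum]

theorem tensorCost_append (l m : List (E × F)) :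
    tensorCost (l ++ m) = tensorCost l + tensorCost m := by
  simp [tensorCost]

theorem exists_tensorSum (z : AlgTensor E F) : ∃ l : List (E × F), tensorSum l = z := by
  refine TensorProduct.induction_on (R := ℝ) (M := E) (N := F)
    (motive := fun z => ∃ l : List (E × F), tensorSum l = (z : AlgTensor E F)) z ?_ ?_ ?_
  · exact ⟨[], rfl⟩
  · intro x y
    exact ⟨[(x, y)], by simp [tensorSum]; rfl⟩
  · rintro a b ⟨l, hl⟩ ⟨m, hm⟩
    exact ⟨l ++ m, by rw [tensorSum_append, hl, hm]; rfl⟩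

theorem projNorm_bddBelow (z : AlgTensor E F) :
    BddBelow (tensorCost '' {l : List (E × F) | tensorSum l = z}) :=
  ⟨0, by rintro _ ⟨l, -, rfl⟩; exact tensorCost_nonneg l⟩

theorem projNorm_le (l : List (E × F)) : ‖tensorSum l‖ ≤ tensorCost l :=
  csInf_le (projNorm_bddBelow _) ⟨l, rfl, rfl⟩

theorem le_projNorm {z : AlgTensor E F} {c : ℝ}
    (h : ∀ l : List (E × F), tensorSum l = z → c ≤ tensorCost l) : c ≤ ‖z‖ := by
  obtain ⟨l, hl⟩ := exists_tensorSum z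
  refine le_csInf ⟨_, l, hl, rfl⟩ ?_
  rintro _ ⟨m, hm, rfl⟩
  exact h m hm

theorem exists_tensorCost_lt (z : AlgTensor E F) {ε : ℝ} (hε : 0 < ε) :
    ∃ l : List (E × F), tensorSum l = z ∧ tensorCost l < ‖z‖ + ε := by
  by_contra! h
  have := le_projNorm (z := z) h
  linarith

theorem projNorm_smul_le (c : ℝ) (z : AlgTensor E F) : ‖c • z‖ ≤ ‖c‖ * ‖z‖ := by
  refine le_of_forall_pos_le_add fun ε hε => ?_
  obtain ⟨l, hl, hc⟩ := exists_tensorCost_lt z (ε := ε / (‖c‖ + 1)) (by positivity)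
  have h1 : tensorSum (l.map fun p => (c • p.1, p.2)) = c • z := by
    rw [← hl]
    clear hl hc
    induction l with
    | nil => simp [tensorSum]
    | cons p l ih =>
      simp only [tensorSum, List.map_cons, List.sum_cons, smul_add] at ih ⊢
      rw [ih, map_smul, LinearMap.smul_apply]
  have h2 : tensorCost (l.map fun p => (c • p.1, p.2)) = ‖c‖ * tensorCost l := by
    rw [tensorCost, tensorCost, List.map_map, ← List.sum_map_mul_left]
    congr 1
    apply List.map_congr_left
    intro p _
    simp [norm_smul, mul_assoc]
  calc ‖c • z‖ ≤ ‖c‖ * tensorCost l := by rw [← h1, ← h2]; exact projNorm_le _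
    _ ≤ ‖c‖ * (‖z‖ + ε / (‖c‖ + 1)) := by gcongr
    _ = ‖c‖ * ‖z‖ + ε * (‖c‖ / (‖c‖ + 1)) := by ring
    _ ≤ ‖c‖ * ‖z‖ + ε * 1 := by
        gcongr
        rw [div_le_one (by positivity)]
        linarith
    _ = ‖c‖ * ‖z‖ + ε := by ring

theorem projNorm_core : SeminormedSpace.Core ℝ (AlgTensor E F) where
  norm_nonneg z := le_projNorm fun l _ => tensorCost_nonneg l
  norm_smul c z := by
    refine le_antisymm (projNorm_smul_le c z) ?_
    rcases eq_or_ne c 0 with rfl | hc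
    · simpa using! le_projNorm (z := (0 : ℝ) • z) fun l _ => tensorCost_nonneg l
    · have h := projNorm_smul_le c⁻¹ (c • z)
      rw [smul_smul, inv_mul_cancel₀ hc, one_smul, norm_inv] at h
      rwa [← le_inv_mul_iff₀ (norm_pos_iff.2 hc)]
  norm_triangle a b := by
    refine le_of_forall_pos_le_add fun ε hε => ?_
    obtain ⟨l, hl, hlc⟩ := exists_tensorCost_lt a (half_pos hε)
    obtain ⟨m, hm, hmc⟩ := exists_tensorCost_lt b (half_pos hε)
    have := projNorm_le (l ++ m)
    rw [tensorSum_append, tensorCost_append, hl, hm] at this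
    linarith

instance : SeminormedAddCommGroup (AlgTensor E F) := SeminormedAddCommGroup.ofCore projNorm_core

instance : NormedSpace ℝ (AlgTensor E F) := ⟨projNorm_smul_le⟩

variable (E F) in
/-- The (completed) projective tensor product `E ⊗ F`, a Banach space. -/
abbrev ProjTensor : Type _ := UniformSpace.Completion (AlgTensor E F)

/-- The elementary tensor `x ⊗ y`. -/
def ptmul (x : E) (y : F) : ProjTensor E F :=
  ((atmul x y : AlgTensor E F) : ProjTensor E F)

theorem norm_lift_le (B : E →L[ℝ] F →L[ℝ] G) (z : AlgTensor E F) :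
    ‖algLiftLin B z‖ ≤ ‖B‖ * ‖z‖ := by
  have key : ∀ l : List (E × F), ‖algLiftLin B (tensorSum l)‖ ≤ ‖B‖ * tensorCost l := by
    intro l
    induction l with
    | nil => simp [tensorSum, tensorCost]
    | cons p l ih =>
      have h : algLiftLin B (tensorSum (p :: l)) = B p.1 p.2 + algLiftLin B (tensorSum l) := by
        rw [← algLiftLin_atmul, ← map_add]
        rfl
      have h2 : tensorCost (p :: l) = ‖p.1‖ * ‖p.2‖ + tensorCost l := by simp [tensorCost]
      rw [h, h2, mul_add, ← mul_assoc]
      exact (norm_add_le _ _).trans (add_le_add (B.le_opNorm₂ _ _) ih)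
  rcases (norm_nonneg B).eq_or_lt with h0 | h0
  · obtain ⟨l, rfl⟩ := exists_tensorSum z
    have := key l
    rw [← h0, zero_mul] at this
    rwa [← h0, zero_mul]
  · rw [← div_le_iff₀' h0]
    refine le_projNorm fun l hl => ?_
    rw [div_le_iff₀' h0, ← hl]
    exact key l

/-- `algLiftLin B` as a bounded operator for the projective norm. -/
def algLift (B : E →L[ℝ] F →L[ℝ] G) : AlgTensor E F →L[ℝ] G :=
  LinearMap.mkContinuous (algLiftLin B) ‖B‖ (norm_lift_le B)

/-- The bounded linear map `E ⊗ F → G` with `x ⊗ y ↦ B x y`; this is the identification of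
`𝓛(E; 𝓛(F; G))` with `𝓛(E ⊗ F; G)`. -/
def plift [CompleteSpace G] (B : E →L[ℝ] F →L[ℝ] G) : ProjTensor E F →L[ℝ] G :=
  (algLift B).extend UniformSpace.Completion.toComplL

theorem plift_ptmul [CompleteSpace G] (B : E →L[ℝ] F →L[ℝ] G) (x : E) (y : F) :
    plift B (ptmul x y) = B x y := by
  have h := ContinuousLinearMap.extend_eq (algLift B)
    (e := (UniformSpace.Completion.toComplL : AlgTensor E F →L[ℝ] ProjTensor E F))
    UniformSpace.Completion.denseRange_coe (UniformSpace.Completion.isUniformInducing_coe _)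
    (atmul x y : AlgTensor E F)
  exact h.trans (algLiftLin_atmul B x y)

theorem norm_ptmul_le (x : E) (y : F) : ‖ptmul x y‖ ≤ ‖x‖ * ‖y‖ := by
  rw [ptmul, UniformSpace.Completion.norm_coe]
  simpa [tensorSum, tensorCost] using projNorm_le [(x, y)]

variable (E F) in
/-- The bounded bilinear map `(x, y) ↦ x ⊗ y`. -/
def ptmulL : E →L[ℝ] F →L[ℝ] ProjTensor E F :=
  LinearMap.mkContinuous₂
    (LinearMap.mk₂ ℝ (fun x y => (ptmul x y : ProjTensor E F))
      (fun a b y => by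
        unfold ptmul
        rw [← UniformSpace.Completion.coe_add, map_add, LinearMap.add_apply])
      (fun c x y => by
        unfold ptmul
        rw [← UniformSpace.Completion.coe_smul, map_smul, LinearMap.smul_apply])
      (fun x a b => by
        unfold ptmul
        rw [← UniformSpace.Completion.coe_add, map_add])
      (fun c x y => by
        unfold ptmul
        rw [← UniformSpace.Completion.coe_smul, map_smul]))
    1 (fun x y => by simpa using norm_ptmul_le x y)

variable (E) in
/-- The transpose on `E ⊗ E`: `x ⊗ y ↦ y ⊗ x`. -/
def pswap : ProjTensor E E →L[ℝ] ProjTensor E E := plift (ptmulL E E).flip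

/-- The bilinear map `(x, y) ↦ A x (B y)`. -/
def bil {E₁ E₂ : Type*} [NormedAddCommGroup E₁] [NormedSpace ℝ E₁]
    [NormedAddCommGroup E₂] [NormedSpace ℝ E₂]
    (A : E₁ →L[ℝ] F →L[ℝ] G) (B : E₂ →L[ℝ] F) : E₁ →L[ℝ] E₂ →L[ℝ] G :=
  ((ContinuousLinearMap.compL ℝ E₂ F G).flip B).comp A

theorem bil_apply {E₁ E₂ : Type*} [NormedAddCommGroup E₁] [NormedSpace ℝ E₁]
    [NormedAddCommGroup E₂] [NormedSpace ℝ E₂]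
    (A : E₁ →L[ℝ] F →L[ℝ] G) (B : E₂ →L[ℝ] F) (x : E₁) (y : E₂) : bil A B x y = A x (B y) := rfl

/-- The tensor product `A ⊗ B` of two bounded operators: `x ⊗ y ↦ A x ⊗ B y`. -/
def pmap {E₁ E₂ : Type*} [NormedAddCommGroup E₁] [NormedSpace ℝ E₁]
    [NormedAddCommGroup E₂] [NormedSpace ℝ E₂]
    (A : E₁ →L[ℝ] E) (B : E₂ →L[ℝ] F) : ProjTensor E₁ E₂ →L[ℝ] ProjTensor E F :=
  plift (bil ((ptmulL E F).comp A) B)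

end Tensor

/-! ### The weighted space `𝒞^β(V; V)` -/

section Growth

variable {V : Type*} [NormedAddCommGroup V] [NormedSpace ℝ V] {n : ℕ}

/-- `‖Dᵏφ(x)‖ / (1 + ‖x‖)^βₖ`. -/
def growthRatio (β : Fin (n + 1) → ℝ) (φ : V → V) (k : Fin (n + 1)) (x : V) : ℝ :=
  ‖iteratedFDeriv ℝ k φ x‖ / (1 + ‖x‖) ^ β k

theorem growthRatio_nonneg (β : Fin (n + 1) → ℝ) (φ : V → V) (k : Fin (n + 1)) (x : V) :
    0 ≤ growthRatio β φ k x := by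
  unfold growthRatio
  positivity

theorem contDiffAt_of_fin {φ : V → V} (h : ContDiff ℝ n φ) (k : Fin (n + 1)) (x : V) :
    ContDiffAt ℝ (k : ℕ) φ x :=
  h.contDiffAt.of_le (by exact_mod_cast Nat.lt_succ_iff.1 k.2)

theorem growthRatio_add_le (β : Fin (n + 1) → ℝ) {φ ψ : V → V} (hφ : ContDiff ℝ n φ)
    (hψ : ContDiff ℝ n ψ) (k : Fin (n + 1)) (x : V) :
    growthRatio β (φ + ψ) k x ≤ growthRatio β φ k x + growthRatio β ψ k x := by
  unfold growthRatio
  rw [iteratedFDeriv_add_apply (contDiffAt_of_fin hφ k x) (contDiffAt_of_fin hψ k x), ← add_div]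
  gcongr
  exact norm_add_le _ _

theorem growthRatio_smul (β : Fin (n + 1) → ℝ) (c : ℝ) {φ : V → V} (hφ : ContDiff ℝ n φ)
    (k : Fin (n + 1)) (x : V) :
    growthRatio β (c • φ) k x = ‖c‖ * growthRatio β φ k x := by
  unfold growthRatio
  rw [iteratedFDeriv_const_smul_apply (contDiffAt_of_fin hφ k x), norm_smul, mul_div_assoc]

theorem growthRatio_zero (β : Fin (n + 1) → ℝ) (k : Fin (n + 1)) (x : V) :
    growthRatio β (0 : V → V) k x = 0 := by
  have h := growthRatio_smul (V := V) β 0 (φ := 0) contDiff_zero_fun k x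
  simpa using h

/-- The `n` times continuously differentiable `φ : V → V` such that `‖Dᵏφ(x)‖ / (1 + ‖x‖)^βₖ` is
bounded in `x` for every `k = 0, …, n`. -/
def growthSubmodule (V : Type*) [NormedAddCommGroup V] [NormedSpace ℝ V]
    (β : Fin (n + 1) → ℝ) : Submodule ℝ (V → V) where
  carrier := {φ | ContDiff ℝ n φ ∧ ∀ k, BddAbove (Set.range (growthRatio β φ k))}
  zero_mem' := by
    refine ⟨contDiff_zero_fun, fun k => ⟨0, ?_⟩⟩
    rintro _ ⟨x, rfl⟩
    exact (growthRatio_zero β k x).le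
  add_mem' := by
    rintro φ ψ ⟨hφ, hφb⟩ ⟨hψ, hψb⟩
    refine ⟨hφ.add hψ, fun k => ?_⟩
    obtain ⟨a, ha⟩ := hφb k
    obtain ⟨b, hb⟩ := hψb k
    refine ⟨a + b, ?_⟩
    rintro _ ⟨x, rfl⟩
    exact (growthRatio_add_le β hφ hψ k x).trans (add_le_add (ha ⟨x, rfl⟩) (hb ⟨x, rfl⟩))
  smul_mem' := by
    rintro c φ ⟨hφ, hφb⟩
    refine ⟨contDiff_const.smul hφ, fun k => ?_⟩
    obtain ⟨a, ha⟩ := hφb k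
    refine ⟨‖c‖ * a, ?_⟩
    rintro _ ⟨x, rfl⟩
    rw [growthRatio_smul β c hφ k x]
    exact mul_le_mul_of_nonneg_left (ha ⟨x, rfl⟩) (norm_nonneg c)

/-- The space `𝒞^β(V; V)`, `β = (β₀, …, βₙ)`. -/
def GrowthSpace (V : Type*) [NormedAddCommGroup V] [NormedSpace ℝ V]
    (β : Fin (n + 1) → ℝ) : Type _ := growthSubmodule V β

namespace GrowthSpace

variable {β : Fin (n + 1) → ℝ}

instance : AddCommGroup (GrowthSpace V β) := inferInstanceAs (AddCommGroup (growthSubmodule V β))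

instance : Module ℝ (GrowthSpace V β) := inferInstanceAs (Module ℝ (growthSubmodule V β))

instance : CoeFun (GrowthSpace V β) (fun _ => V → V) := ⟨fun φ => φ.1⟩

/-- The norm `∑ₖ supₓ ‖Dᵏφ(x)‖ / (1 + ‖x‖)^βₖ`. -/
instance : Norm (GrowthSpace V β) := ⟨fun φ => ∑ k, ⨆ x, growthRatio β φ k x⟩

theorem coe_add (φ ψ : GrowthSpace V β) : ((φ + ψ : GrowthSpace V β) : V → V) = φ + ψ := rfl

theorem coe_smul (c : ℝ) (φ : GrowthSpace V β) : ((c • φ : GrowthSpace V β) : V → V) = c • ⇑φ := rfl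

theorem contDiff (φ : GrowthSpace V β) : ContDiff ℝ n φ := φ.2.1

theorem bdd (φ : GrowthSpace V β) (k : Fin (n + 1)) :
    BddAbove (Set.range (growthRatio β φ k)) := φ.2.2 k

theorem norm_def (φ : GrowthSpace V β) : ‖φ‖ = ∑ k, ⨆ x, growthRatio β φ k x := rfl

theorem norm_iteratedFDeriv_le (φ : GrowthSpace V β) (k : Fin (n + 1)) (x : V) :
    ‖iteratedFDeriv ℝ k φ x‖ ≤ (1 + ‖x‖) ^ β k * ‖φ‖ := by
  have hpos : (0 : ℝ) < (1 + ‖x‖) ^ β k := by positivity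
  have h1 : growthRatio β φ k x ≤ ⨆ x, growthRatio β φ k x := le_ciSup (φ.bdd k) x
  have h2 : (⨆ x, growthRatio β φ k x) ≤ ‖φ‖ :=
    Finset.single_le_sum (f := fun k => ⨆ x, growthRatio β φ k x)
      (fun i _ => Real.iSup_nonneg fun y => growthRatio_nonneg β φ i y) (Finset.mem_univ k)
  exact (div_le_iff₀' hpos).1 (h1.trans h2)

theorem norm_core : NormedSpace.Core ℝ (GrowthSpace V β) where
  norm_nonneg φ := Finset.sum_nonneg fun k _ =>
    Real.iSup_nonneg fun x => growthRatio_nonneg β φ k x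
  norm_smul c φ := by
    rw [norm_def, norm_def, Finset.mul_sum]
    refine Finset.sum_congr rfl fun k _ => ?_
    rw [Real.mul_iSup_of_nonneg (norm_nonneg c)]
    exact congrArg _ (funext fun x => growthRatio_smul β c φ.contDiff k x)
  norm_triangle φ ψ := by
    rw [norm_def, norm_def, norm_def, ← Finset.sum_add_distrib]
    refine Finset.sum_le_sum fun k _ => ciSup_le fun x => ?_
    exact (growthRatio_add_le β φ.contDiff ψ.contDiff k x).trans
      (add_le_add (le_ciSup (φ.bdd k) x) (le_ciSup (ψ.bdd k) x))
  norm_eq_zero_iff φ := by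
    constructor
    · intro h
      refine Subtype.ext (funext fun x => ?_)
      have := norm_iteratedFDeriv_le φ 0 x
      rw [h, mul_zero, Fin.val_zero, norm_iteratedFDeriv_zero] at this
      exact norm_le_zero_iff.1 this
    · rintro rfl
      rw [norm_def]
      refine Finset.sum_eq_zero fun k _ => ?_
      have : (fun x => growthRatio β ((0 : GrowthSpace V β) : V → V) k x) = fun _ => 0 :=
        funext fun x => growthRatio_zero β k x
      rw [this]
      simp

instance : NormedAddCommGroup (GrowthSpace V β) := NormedAddCommGroup.ofCore norm_core

instance : NormedSpace ℝ (GrowthSpace V β) := NormedSpace.ofCore norm_core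

variable (β) in
/-- The evaluation `φ ↦ φ(y)`. -/
def eval (y : V) : GrowthSpace V β →L[ℝ] V :=
  LinearMap.mkContinuous
    { toFun := fun φ : GrowthSpace V β => φ y
      map_add' := fun _ _ => rfl
      map_smul' := fun _ _ => rfl }
    ((1 + ‖y‖) ^ β 0)
    (fun φ => by
      have h := norm_iteratedFDeriv_le φ 0 y
      rw [Fin.val_zero, norm_iteratedFDeriv_zero] at h
      exact h)

theorem differentiable (hn : 1 ≤ n) (φ : GrowthSpace V β) : Differentiable ℝ φ :=
  φ.contDiff.differentiable (by simp; omega)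

theorem differentiable_fderiv (hn : 2 ≤ n) (φ : GrowthSpace V β) :
    Differentiable ℝ (fderiv ℝ φ) :=
  (φ.contDiff.fderiv_right (m := 1) (by norm_cast)).differentiable (by simp)

theorem fderiv_add (hn : 1 ≤ n) (φ ψ : GrowthSpace V β) :
    fderiv ℝ (φ + ψ : GrowthSpace V β) = fderiv ℝ φ + fderiv ℝ ψ :=
  funext fun y => _root_.fderiv_add (differentiable hn φ y) (differentiable hn ψ y)

theorem fderiv_smul (hn : 1 ≤ n) (c : ℝ) (φ : GrowthSpace V β) :
    fderiv ℝ (c • φ : GrowthSpace V β) = c • fderiv ℝ φ :=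
  funext fun y => fderiv_const_smul (differentiable hn φ y) c

variable (β) in
/-- The evaluation of the derivative, `φ ↦ Dφ(y)`. -/
def evalD (hn : 1 ≤ n) (y : V) : GrowthSpace V β →L[ℝ] V →L[ℝ] V :=
  LinearMap.mkContinuous
    { toFun := fun φ : GrowthSpace V β => fderiv ℝ φ y
      map_add' := fun φ ψ => by rw [fderiv_add hn]; rfl
      map_smul' := fun c φ => by rw [fderiv_smul hn]; rfl }
    ((1 + ‖y‖) ^ β ⟨1, by omega⟩)
    (fun φ => by
      have h := norm_iteratedFDeriv_le φ ⟨1, by omega⟩ y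
      rw [norm_iteratedFDeriv_one] at h
      exact h)

variable (β) in
/-- The evaluation of the second derivative, `φ ↦ D²φ(y)`. -/
def evalD2 (hn : 2 ≤ n) (y : V) : GrowthSpace V β →L[ℝ] V →L[ℝ] V →L[ℝ] V :=
  LinearMap.mkContinuous
    { toFun := fun φ : GrowthSpace V β => fderiv ℝ (fderiv ℝ φ) y
      map_add' := fun φ ψ => by
        rw [fderiv_add (by omega)]
        exact _root_.fderiv_add (differentiable_fderiv hn φ y) (differentiable_fderiv hn ψ y)
      map_smul' := fun c φ => by
        rw [fderiv_smul (by omega)]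
        exact fderiv_const_smul (differentiable_fderiv hn φ y) c }
    ((1 + ‖y‖) ^ β ⟨2, by omega⟩)
    (fun φ => by
      have h := norm_iteratedFDeriv_le φ ⟨2, by omega⟩ y
      rw [← norm_iteratedFDeriv_fderiv, norm_iteratedFDeriv_one] at h
      exact h)

end GrowthSpace

end Growth

/-! ### Hölder functions, rough paths, controlled paths -/

section Paths

variable {E K : Type*} [NormedAddCommGroup E] [NormedSpace ℝ E]
  [NormedAddCommGroup K] [NormedSpace ℝ K]

/-- `Φ ∈ 𝒞^α([0,T]; E)`. Paths are functions on `ℝ` of which only the values on `[0,T]` matter. -/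
def IsHolder (α T : ℝ) (Φ : ℝ → E) : Prop :=
  ∃ C : ℝ, ∀ s ∈ Set.Icc 0 T, ∀ t ∈ Set.Icc 0 T, s ≠ t → ‖Φ t - Φ s‖ ≤ C * |t - s| ^ α

/-- `Ψ ∈ 𝒞₂^α([0,T]²; E)`. -/
def IsHolderTwo (α T : ℝ) (Ψ : ℝ → ℝ → E) : Prop :=
  ∃ C : ℝ, ∀ s ∈ Set.Icc 0 T, ∀ t ∈ Set.Icc 0 T, s ≠ t → ‖Ψ s t‖ ≤ C * |t - s| ^ α

/-- `(X, 𝕏)` is an `E`-valued `α`-Hölder rough path on `[0,T]`. -/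
structure IsRoughPath (α T : ℝ) (X : ℝ → E) (XX : ℝ → ℝ → ProjTensor E E) : Prop where
  holder : IsHolder α T X
  holderTwo : IsHolderTwo (2 * α) T XX
  chen : ∀ s ∈ Set.Icc 0 T, ∀ u ∈ Set.Icc 0 T, ∀ t ∈ Set.Icc 0 T,
    XX s t - XX s u - XX u t = ptmul (X u - X s) (X t - X u)

/-- `(Y, Y') ∈ 𝒟_X^{2α}(K)`: the path `Y` is controlled by `X` with Gubinelli derivative `Y'`. -/
structure IsControlled (α T : ℝ) (X : ℝ → E) (Y : ℝ → K) (Y' : ℝ → E →L[ℝ] K) : Prop where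
  holder : IsHolder α T Y
  holder_deriv : IsHolder α T Y'
  holder_remainder : IsHolderTwo (2 * α) T (fun s t => Y t - Y s - Y' s (X t - X s))

end Paths

/-! ### Limits of Riemann sums -/

section RiemannSums

variable {K : Type*} [NormedAddCommGroup K]

/-- `s = p 0 < p 1 < ⋯ < p n = t` is a partition of `[s,t]` of mesh less than `δ`. -/
def IsPartition (s t δ : ℝ) (n : ℕ) (p : ℕ → ℝ) : Prop :=
  p 0 = s ∧ p n = t ∧ ∀ k < n, p k < p (k + 1) ∧ p (k + 1) - p k < δ

/-- `I = lim_{|π| → 0} ∑ₖ Ξ_{tₖ₋₁,tₖ}` over partitions `π` of `[s,t]`, where `s ≤ t`. -/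
def IsRiemannLim (Ξ : ℝ → ℝ → K) (s t : ℝ) (I : K) : Prop :=
  ∀ ε > 0, ∃ δ > 0, ∀ (n : ℕ) (p : ℕ → ℝ), IsPartition s t δ n p →
    ‖(∑ k ∈ Finset.range n, Ξ (p k) (p (k + 1))) - I‖ < ε

/-- The limit of the Riemann sums of `Ξ` over partitions of `[s,t]` exists, where `s ≤ t`. -/
def RiemannLimExists (Ξ : ℝ → ℝ → K) (s t : ℝ) : Prop := ∃ I : K, IsRiemannLim Ξ s t I

open Classical in
/-- The limit of the Riemann sums of `Ξ` over partitions of `[s,t]`, where `s ≤ t`, with the junk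
value `0` if there is none. -/
def riemannLim (Ξ : ℝ → ℝ → K) (s t : ℝ) : K :=
  if h : RiemannLimExists Ξ s t then h.choose else 0

open Classical in
/-- The integral from `s` to `t` with germ `Ξ`, with the usual sign if `t < s`. -/
def germInt (Ξ : ℝ → ℝ → K) (s t : ℝ) : K :=
  if s ≤ t then riemannLim Ξ s t else -riemannLim Ξ t s

end RiemannSums

/-! ### Integrals of controlled paths and quadratic compensators -/

section Integrals

variable {E K K₁ K₂ : Type*} [NormedAddCommGroup E] [NormedSpace ℝ E]
  [NormedAddCommGroup K] [NormedSpace ℝ K] [CompleteSpace K]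
  [NormedAddCommGroup K₁] [NormedSpace ℝ K₁] [NormedAddCommGroup K₂] [NormedSpace ℝ K₂]

/-- The germ `Z_u ⊗ Y_{u,v} + (Z'_u ⊗ Y'_u) 𝕏_{u,v}` of `∫ Z ⊗ dY`. -/
def germTensor (XX : ℝ → ℝ → ProjTensor E E) (Z : ℝ → K₂) (Z' : ℝ → E →L[ℝ] K₂)
    (Y : ℝ → K₁) (Y' : ℝ → E →L[ℝ] K₁) (u v : ℝ) : ProjTensor K₂ K₁ :=
  ptmul (Z u) (Y v - Y u) + pmap (Z' u) (Y' u) (XX u v)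

/-- The germ `Z_u Y_{u,v} + (Z'_u Y'_u) 𝕏_{u,v}` of `∫ Z dY`, where
`(Z'_u Y'_u)(x ⊗ y) = Z'_u(x)[Y'_u(y)]`. -/
def germLeft (XX : ℝ → ℝ → ProjTensor E E) (Z : ℝ → K₁ →L[ℝ] K) (Z' : ℝ → E →L[ℝ] K₁ →L[ℝ] K)
    (Y : ℝ → K₁) (Y' : ℝ → E →L[ℝ] K₁) (u v : ℝ) : K :=
  Z u (Y v - Y u) + plift (bil (Z' u) (Y' u)) (XX u v)

/-- The germ `Z_{u,v} Y_u + (Z'_u Y'_u) 𝕏*_{u,v}` of `∫ dZ(Y)`. -/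
def germRight (XX : ℝ → ℝ → ProjTensor E E) (Z : ℝ → K₁ →L[ℝ] K) (Z' : ℝ → E →L[ℝ] K₁ →L[ℝ] K)
    (Y : ℝ → K₁) (Y' : ℝ → E →L[ℝ] K₁) (u v : ℝ) : K :=
  (Z v - Z u) (Y u) + plift (bil (Z' u) (Y' u)) (pswap E (XX u v))

/-- The germ of `∫ Y_{s,r} ⊗ dY_r` (with `s` fixed). -/
def compTensorGerm (XX : ℝ → ℝ → ProjTensor E E) (Y : ℝ → K₁) (Y' : ℝ → E →L[ℝ] K₁) (s : ℝ) :
    ℝ → ℝ → ProjTensor K₁ K₁ :=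
  germTensor XX (fun r => Y r - Y s) Y' Y Y'

/-- The quadratic compensator `⟨Y⟩_{s,t} = Y_{s,t} ⊗ Y_{s,t} - 2 ∫_s^t Y_{s,r} ⊗ dY_r`. -/
def compTensor (XX : ℝ → ℝ → ProjTensor E E) (Y : ℝ → K₁) (Y' : ℝ → E →L[ℝ] K₁) (s t : ℝ) :
    ProjTensor K₁ K₁ :=
  ptmul (Y t - Y s) (Y t - Y s) - (2 : ℝ) • germInt (compTensorGerm XX Y Y' s) s t

/-- The germ of `∫ Z_{s,r} dY_r` (with `s` fixed). -/
def compLeftGerm (XX : ℝ → ℝ → ProjTensor E E) (Z : ℝ → K₁ →L[ℝ] K)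
    (Z' : ℝ → E →L[ℝ] K₁ →L[ℝ] K) (Y : ℝ → K₁) (Y' : ℝ → E →L[ℝ] K₁) (s : ℝ) : ℝ → ℝ → K :=
  germLeft XX (fun r => Z r - Z s) Z' Y Y'

/-- The compensator `⟪Z, Y⟫_{s,t} = Z_{s,t} Y_{s,t} - 2 ∫_s^t Z_{s,r} dY_r`, for `Z` with values
in `𝓛(K₁; K)`. -/
def compLeft (XX : ℝ → ℝ → ProjTensor E E) (Z : ℝ → K₁ →L[ℝ] K) (Z' : ℝ → E →L[ℝ] K₁ →L[ℝ] K)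
    (Y : ℝ → K₁) (Y' : ℝ → E →L[ℝ] K₁) (s t : ℝ) : K :=
  (Z t - Z s) (Y t - Y s) - (2 : ℝ) • germInt (compLeftGerm XX Z Z' Y Y' s) s t

/-- The germ of `∫ dZ_r (Y_{s,r})` (with `s` fixed). -/
def compRightGerm (XX : ℝ → ℝ → ProjTensor E E) (Z : ℝ → K₁ →L[ℝ] K)
    (Z' : ℝ → E →L[ℝ] K₁ →L[ℝ] K) (Y : ℝ → K₁) (Y' : ℝ → E →L[ℝ] K₁) (s : ℝ) : ℝ → ℝ → K :=
  germRight XX Z Z' (fun r => Y r - Y s) Y'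

/-- The compensator `⟪Y, Z⟫_{s,t} = Z_{s,t} Y_{s,t} - 2 ∫_s^t dZ_r (Y_{s,r})`, for `Z` with values
in `𝓛(K₁; K)`. -/
def compRight (XX : ℝ → ℝ → ProjTensor E E) (Z : ℝ → K₁ →L[ℝ] K) (Z' : ℝ → E →L[ℝ] K₁ →L[ℝ] K)
    (Y : ℝ → K₁) (Y' : ℝ → E →L[ℝ] K₁) (s t : ℝ) : K :=
  (Z t - Z s) (Y t - Y s) - (2 : ℝ) • germInt (compRightGerm XX Z Z' Y Y' s) s t

/-- The germ `A_u Ψ_{u,v}` of the Young integral `∫ A dΨ` of an operator-valued path against a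
two-parameter function. -/
def youngGerm (A : ℝ → K₁ →L[ℝ] K) (Ψ : ℝ → ℝ → K₁) (u v : ℝ) : K := A u (Ψ u v)

end Integrals

/-! ### The paths built from `W`, `Y` and `Z`, where `W` takes values in `𝒞^β(V; V)` -/

section Composite

variable {V K : Type*} [NormedAddCommGroup V] [NormedSpace ℝ V] [CompleteSpace V]
  [NormedAddCommGroup K] [NormedSpace ℝ K] [CompleteSpace K] {β : Fin (3 + 1) → ℝ}

/-- `δ_y : φ ↦ φ(y)` on `𝒞^β(V; V)`, `β = (β₀, β₁, β₂, β₃)`. -/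
abbrev ev (β : Fin (3 + 1) → ℝ) (y : V) : GrowthSpace V β →L[ℝ] V := GrowthSpace.eval β y

/-- `φ ↦ Dφ(y)`. -/
abbrev evD (β : Fin (3 + 1) → ℝ) (y : V) : GrowthSpace V β →L[ℝ] V →L[ℝ] V :=
  GrowthSpace.evalD β (by norm_num) y

/-- `φ ↦ D²φ(y)`. -/
abbrev evD2 (β : Fin (3 + 1) → ℝ) (y : V) : GrowthSpace V β →L[ℝ] V →L[ℝ] V →L[ℝ] V :=
  GrowthSpace.evalD2 β (by norm_num) y

/-- `F_t = W(t, Y_t)`. -/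
def pathF (W : ℝ → GrowthSpace V β) (Y : ℝ → V) (t : ℝ) : V := W t (Y t)

/-- The Gubinelli derivative of `F`: `F'_t φ = φ(Y_t) + DW(t, Y_t)(Y'_t φ)`. -/
def pathF' (W : ℝ → GrowthSpace V β) (Y : ℝ → V) (Y' : ℝ → GrowthSpace V β →L[ℝ] V) (t : ℝ) :
    GrowthSpace V β →L[ℝ] V :=
  ev β (Y t) + (fderiv ℝ (W t) (Y t)).comp (Y' t)

/-- The germ of `∫ W(dr, Y_r)`: `W_{u,v}(Y_u) + B_u 𝒲_{u,v}`, where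
`B_u(φ₁ ⊗ φ₂) = Dφ₂(Y_u)(Y'_u φ₁)`. -/
def germG (W : ℝ → GrowthSpace V β) (WW : ℝ → ℝ → ProjTensor (GrowthSpace V β) (GrowthSpace V β))
    (Y : ℝ → V) (Y' : ℝ → GrowthSpace V β →L[ℝ] V) (u v : ℝ) : V :=
  (W v (Y u) - W u (Y u)) + plift ((evD β (Y u)).flip.comp (Y' u)) (WW u v)

/-- `G_t = ∫_0^t W(dr, Y_r)`. -/
def pathG (W : ℝ → GrowthSpace V β) (WW : ℝ → ℝ → ProjTensor (GrowthSpace V β) (GrowthSpace V β))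
    (Y : ℝ → V) (Y' : ℝ → GrowthSpace V β →L[ℝ] V) (t : ℝ) : V :=
  germInt (germG W WW Y Y') 0 t

/-- The Gubinelli derivative of `G`: `G'_t φ = φ(Y_t)`. -/
def pathG' (β : Fin (3 + 1) → ℝ) (Y : ℝ → V) (t : ℝ) : GrowthSpace V β →L[ℝ] V := ev β (Y t)

/-- The germ of `∫ DW(dr, Y_r)`: `DW_{u,v}(Y_u) + B_u 𝒲_{u,v}`, where
`B_u(φ₁ ⊗ φ₂) = D²φ₂(Y_u)(Y'_u φ₁) ∈ 𝓛(V; V)`. -/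
def germX (W : ℝ → GrowthSpace V β) (WW : ℝ → ℝ → ProjTensor (GrowthSpace V β) (GrowthSpace V β))
    (Y : ℝ → V) (Y' : ℝ → GrowthSpace V β →L[ℝ] V) (u v : ℝ) : V →L[ℝ] V :=
  (fderiv ℝ (W v) (Y u) - fderiv ℝ (W u) (Y u))
    + plift ((evD2 β (Y u)).flip.comp (Y' u)) (WW u v)

/-- `X_t = ∫_0^t DW(dr, Y_r)`. -/
def pathX (W : ℝ → GrowthSpace V β) (WW : ℝ → ℝ → ProjTensor (GrowthSpace V β) (GrowthSpace V β))
    (Y : ℝ → V) (Y' : ℝ → GrowthSpace V β →L[ℝ] V) (t : ℝ) : V →L[ℝ] V :=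
  germInt (germX W WW Y Y') 0 t

/-- The Gubinelli derivative of `X`: `X'_t φ = Dφ(Y_t)`. -/
def pathX' (β : Fin (3 + 1) → ℝ) (Y : ℝ → V) (t : ℝ) : GrowthSpace V β →L[ℝ] V →L[ℝ] V :=
  evD β (Y t)

/-- `H_t = Z_t ∘ DW(t, Y_t)`. -/
def pathH (W : ℝ → GrowthSpace V β) (Y : ℝ → V) (Z : ℝ → V →L[ℝ] K) (t : ℝ) : V →L[ℝ] K :=
  (Z t).comp (fderiv ℝ (W t) (Y t))

/-- The Gubinelli derivative of `H`:
`H'_t φ = Z'_t(φ) ∘ DW(t, Y_t) + Z_t ∘ (Dφ(Y_t) + D²W(t, Y_t)(Y'_t φ))`. -/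
def pathH' (W : ℝ → GrowthSpace V β) (Y : ℝ → V) (Y' : ℝ → GrowthSpace V β →L[ℝ] V)
    (Z : ℝ → V →L[ℝ] K) (Z' : ℝ → GrowthSpace V β →L[ℝ] V →L[ℝ] K) (t : ℝ) :
    GrowthSpace V β →L[ℝ] V →L[ℝ] K :=
  ((ContinuousLinearMap.compL ℝ V V K).flip (fderiv ℝ (W t) (Y t))).comp (Z' t)
    + (ContinuousLinearMap.compL ℝ V V K (Z t)).comp
        (evD β (Y t) + (fderiv ℝ (fderiv ℝ (W t)) (Y t)).comp (Y' t))

/-- `Z_t D²W(t, Y_t)` as an operator on `V ⊗ V`: `x ⊗ y ↦ Z_t[D²W(t, Y_t)(x, y)]`. -/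
def pathA (W : ℝ → GrowthSpace V β) (Y : ℝ → V) (Z : ℝ → V →L[ℝ] K) (t : ℝ) :
    ProjTensor V V →L[ℝ] K :=
  plift ((ContinuousLinearMap.compL ℝ V V K (Z t)).comp (fderiv ℝ (fderiv ℝ (W t)) (Y t)))

/-- `⟪X, Y⟫` for `X = ∫ DW(dr, Y_r)`. -/
def compXY (W : ℝ → GrowthSpace V β) (WW : ℝ → ℝ → ProjTensor (GrowthSpace V β) (GrowthSpace V β))
    (Y : ℝ → V) (Y' : ℝ → GrowthSpace V β →L[ℝ] V) : ℝ → ℝ → V :=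
  compLeft WW (pathX W WW Y Y') (pathX' β Y) Y Y'

/-- `⟪Y, X⟫` for `X = ∫ DW(dr, Y_r)`. -/
def compYX (W : ℝ → GrowthSpace V β) (WW : ℝ → ℝ → ProjTensor (GrowthSpace V β) (GrowthSpace V β))
    (Y : ℝ → V) (Y' : ℝ → GrowthSpace V β →L[ℝ] V) : ℝ → ℝ → V :=
  compRight WW (pathX W WW Y Y') (pathX' β Y) Y Y'

end Composite

end RoughIto

end

/-! Each integral here is the limit of the Riemann sums of a germ, and two germs that differ by
O(|t-s|^θ) with θ > 1 have the same limit. Since 3α > 1, it suffices to show that every germ can be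
sewn and that the germs on the two sides of the formula agree up to order 3α.

Existence. Sewing (`IsAlmostAdditive.exists_path`) needs the defect Ξ_{s,t} - Ξ_{s,u} - Ξ_{u,t} to
have order above 1. For controlled integrals, Chen's relation removes the only term of order 2α
(`hasOrder_germLeft`). The other kinds of rough integral reduce to this one: ∫ Q ⊗ dP and ∫ dQ(P) by
changing the operator-valued integrand, and ∫ W(dr, Y_r) because it is the linear integral of the
evaluations δ_{Y_r} against W itself. The last reduction needs t ↦ δ_{Y_t} to be controlled, which
is a Taylor estimate uniform over the unit ball of E.

Compensators. They are not additive: the defect of ⟪Q, P⟫ is Q_{u,t} P_{s,u} - Q_{s,u} P_{u,t}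
(`compLeft_sub_sub`), in general only of order 2α. This expression is antisymmetric. It is killed by
Z D²W in the case of ⟨Y⟩, because second derivatives are symmetric, and it cancels in ⟪X, Y⟫ + ⟪Y,
X⟫. Hence the Young integrals in the formula exist, while those against ⟪X, Y⟫ and ⟪Y, X⟫ separately
are only known to exist together.

The formula. Expand W(t, Y_t) - W(s, Y_s) to second order (`hasOrder_pathF_taylor`): the terms of
first order in the increments match the germs of dG and H dY, the quadratic term ½ D²W(Y_{s,t},
Y_{s,t}) matches ½ ⟨Y⟩, and the cross term DW_{s,t}(Y_s) Y_{s,t} matches ½ (⟪X, Y⟫ + ⟪Y, X⟫). What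
is left is linear in 𝒲_{s,t} and vanishes by algebra (`second_level_cancel`). `hasOrder_ito`
collects the errors, and uniqueness of Riemann limits concludes. -/

noncomputable section

namespace RoughIto

/-! ### The sewing lemma -/

section Sewing

variable {K : Type*} [NormedAddCommGroup K]

/-- `Ξ` is additive up to an error of order `|t - s|^θ` on `[0,T]`. -/
def IsAlmostAdditive (C θ T : ℝ) (Ξ : ℝ → ℝ → K) : Prop :=
  ∀ s u t, 0 ≤ s → s ≤ u → u ≤ t → t ≤ T → ‖Ξ s t - Ξ s u - Ξ u t‖ ≤ C * (t - s) ^ θ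

variable {Ξ : ℝ → ℝ → K} {C θ T : ℝ}

/-- Taking the three times equal makes the error bound 0. Degenerate intervals therefore contribute
nothing, so sums over truncated partitions with repeated points are harmless. -/
theorem IsAlmostAdditive.diag (h : IsAlmostAdditive C θ T Ξ) (hθ : 1 < θ) {s : ℝ} (hs : 0 ≤ s)
    (hsT : s ≤ T) : Ξ s s = 0 := by
  have := h s s s hs le_rfl le_rfl hsT
  rw [sub_self, sub_self, Real.zero_rpow (by linarith), mul_zero] at this
  simpa using this

theorem two_rpow_one_sub_lt_one (hθ : 1 < θ) : (2 : ℝ) ^ (1 - θ) < 1 :=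
  Real.rpow_lt_one_of_one_lt_of_neg (by norm_num) (by linarith)

/-- The maximal inequality of the sewing lemma. -/
theorem IsAlmostAdditive.norm_sum_sub_le (h : IsAlmostAdditive C θ T Ξ) (hC : 0 ≤ C) (hθ : 1 < θ)
    (n : ℕ) : ∀ p : ℕ → ℝ, Monotone p → 0 ≤ p 0 → p n ≤ T →
      ‖(∑ k ∈ Finset.range n, Ξ (p k) (p (k + 1))) - Ξ (p 0) (p n)‖
        ≤ 2 * C / (1 - 2 ^ (1 - θ)) * (p n - p 0) ^ θ := by
  have hq := two_rpow_one_sub_lt_one hθ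
  have hq' : 0 < 1 - (2 : ℝ) ^ (1 - θ) := by linarith
  -- M is the solution of 2 · 2^{-θ} M + 2C = M: two halves, each at most half as long, plus two
  -- defects.
  set M := 2 * C / (1 - (2 : ℝ) ^ (1 - θ)) with hM
  have hM0 : 0 ≤ M := by positivity
  induction n using Nat.strong_induction_on with
  | _ n ih =>
  intro p hp h0 hT
  rcases Nat.eq_zero_or_pos n with rfl | hn
  · simp [h.diag hθ h0 hT, Real.zero_rpow (by linarith : θ ≠ 0)]
  have h0n : p 0 ≤ p n := hp (Nat.zero_le n)
  set m := (p 0 + p n) / 2 with hm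
  have hex : ∃ j, m ≤ p (j + 1) := ⟨n - 1, by rw [Nat.sub_add_cancel hn]; linarith⟩
  classical
  -- Remove the partition interval containing the midpoint. The pieces to its left and right have
  -- length at most D / 2, so the induction hypothesis gains the factor 2^{-θ} on each.
  obtain ⟨k, hk1, hk2, hkn⟩ : ∃ k, m ≤ p (k + 1) ∧ p k ≤ m ∧ k < n := by
    refine ⟨Nat.find hex, Nat.find_spec hex, ?_, ?_⟩
    · rcases hj : Nat.find hex with _ | j
      · linarith
      · have := Nat.find_min hex (m := j) (by omega)
        linarith
    · have : Nat.find hex ≤ n - 1 := Nat.find_min' hex (by rw [Nat.sub_add_cancel hn]; linarith)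
      omega
  obtain ⟨r, rfl⟩ := Nat.exists_eq_add_of_le (Nat.succ_le_of_lt hkn)
  have e1 : p 0 ≤ p k := hp (Nat.zero_le k)
  have e2 : p k ≤ p (k + 1) := hp (Nat.le_succ k)
  have e3 : p (k + 1) ≤ p (k + 1 + r) := hp (by omega)
  have hL := ih k hkn p hp h0 (by linarith)
  have hR := ih r (by omega) (fun i => p (k + 1 + i)) (fun i j hij => hp (by omega))
    (by simp only [add_zero]; linarith) hT
  simp only [add_zero] at hR
  have d1 := h (p 0) (p k) (p (k + 1 + r)) h0 e1 (by linarith) hT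
  have d2 := h (p k) (p (k + 1)) (p (k + 1 + r)) (by linarith) e2 e3 hT
  simp only [Nat.succ_eq_add_one] at *
  set D := p (k + 1 + r) - p 0 with hD
  have hD0 : 0 ≤ D := by linarith
  have half : ∀ x, 0 ≤ x → x ≤ D / 2 → x ^ θ ≤ (2 : ℝ) ^ (-θ) * D ^ θ := by
    intro x hx0 hx
    calc x ^ θ ≤ (D / 2) ^ θ := Real.rpow_le_rpow hx0 hx (by linarith)
      _ = _ := by
        rw [Real.div_rpow hD0 (by norm_num), Real.rpow_neg (by norm_num)]
        field_simp
  have b1 : M * (p k - p 0) ^ θ ≤ M * ((2 : ℝ) ^ (-θ) * D ^ θ) :=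
    mul_le_mul_of_nonneg_left (half _ (by linarith) (by linarith)) hM0
  have b2 : M * (p (k + 1 + r) - p (k + 1)) ^ θ ≤ M * ((2 : ℝ) ^ (-θ) * D ^ θ) :=
    mul_le_mul_of_nonneg_left (half _ (by linarith) (by linarith)) hM0
  have b3 : C * (p (k + 1 + r) - p k) ^ θ ≤ C * D ^ θ :=
    mul_le_mul_of_nonneg_left
      (Real.rpow_le_rpow (by linarith) (by linarith) (by linarith)) hC
  have key : 2 * (M * (2 : ℝ) ^ (-θ)) + 2 * C = M := by
    have : (2 : ℝ) ^ (1 - θ) = 2 * 2 ^ (-θ) := by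
      rw [sub_eq_add_neg, Real.rpow_add (by norm_num), Real.rpow_one]
    rw [hM, this]
    rw [this] at hq'
    field_simp
    ring
  have split : (∑ i ∈ Finset.range (k + 1 + r), Ξ (p i) (p (i + 1))) - Ξ (p 0) (p (k + 1 + r))
      = ((∑ i ∈ Finset.range k, Ξ (p i) (p (i + 1))) - Ξ (p 0) (p k))
        + ((∑ i ∈ Finset.range r, Ξ (p (k + 1 + i)) (p (k + 1 + (i + 1))))
          - Ξ (p (k + 1)) (p (k + 1 + r)))
        - (Ξ (p 0) (p (k + 1 + r)) - Ξ (p 0) (p k) - Ξ (p k) (p (k + 1 + r)))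
        - (Ξ (p k) (p (k + 1 + r)) - Ξ (p k) (p (k + 1)) - Ξ (p (k + 1)) (p (k + 1 + r))) := by
    rw [Finset.sum_range_add, Finset.sum_range_succ]
    simp only [add_assoc]
    abel
  rw [split]
  calc _ ≤ M * (p k - p 0) ^ θ + M * (p (k + 1 + r) - p (k + 1)) ^ θ + C * D ^ θ
        + C * (p (k + 1 + r) - p k) ^ θ :=
        (norm_sub_le _ _).trans (add_le_add ((norm_sub_le _ _).trans
          (add_le_add ((norm_add_le _ _).trans (add_le_add hL hR)) d1)) d2)
    _ ≤ (2 * (M * (2 : ℝ) ^ (-θ)) + 2 * C) * D ^ θ := by linarith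
    _ = M * D ^ θ := by rw [key]

theorem sum_range_two_mul {M : Type*} [AddCommMonoid M] (f : ℕ → M) (m : ℕ) :
    ∑ k ∈ Finset.range (2 * m), f k = ∑ k ∈ Finset.range m, (f (2 * k) + f (2 * k + 1)) := by
  induction m with
  | zero => simp
  | succ m ih =>
    rw [show 2 * (m + 1) = 2 * m + 1 + 1 by ring, Finset.sum_range_succ, Finset.sum_range_succ, ih,
      Finset.sum_range_succ, add_assoc]

/-- The `k`-th point of the dyadic partition of `[0,T]` into `2^n` intervals. -/
def dyadicPoint (T : ℝ) (n k : ℕ) : ℝ := T * k / 2 ^ n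

theorem dyadicPoint_mono (hT : 0 ≤ T) (n : ℕ) : Monotone (dyadicPoint T n) := by
  intro i j hij
  unfold dyadicPoint
  gcongr

theorem dyadicPoint_zero (n : ℕ) : dyadicPoint T n 0 = 0 := by simp [dyadicPoint]

theorem dyadicPoint_last (n : ℕ) : dyadicPoint T n (2 ^ n) = T := by
  simp [dyadicPoint]

theorem dyadicPoint_succ_two_mul (n k : ℕ) :
    dyadicPoint T (n + 1) (2 * k) = dyadicPoint T n k := by
  simp only [dyadicPoint, Nat.cast_mul, Nat.cast_ofNat, pow_succ]
  field_simp

theorem dyadicPoint_succ_sub (n k : ℕ) :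
    dyadicPoint T n (k + 1) - dyadicPoint T n k = T / 2 ^ n := by
  simp only [dyadicPoint, Nat.cast_add, Nat.cast_one]
  ring

/-- The Riemann sum of `Ξ` over the trace on `[0,t]` of the dyadic partition of `[0,T]`. -/
def dyadicSum (T : ℝ) (Ξ : ℝ → ℝ → K) (n : ℕ) (t : ℝ) : K :=
  ∑ k ∈ Finset.range (2 ^ n), Ξ (min (dyadicPoint T n k) t) (min (dyadicPoint T n (k + 1)) t)

/-- The sum of one error (mesh)^θ per dyadic interval is geometric in n with ratio 2^{1-θ}, which is
below 1 when θ > 1. -/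
theorem two_pow_mul_mesh (hT : 0 ≤ T) (n : ℕ) :
    (2 : ℝ) ^ n * (T / 2 ^ n) ^ θ = T ^ θ * ((2 : ℝ) ^ (1 - θ)) ^ n := by
  rw [Real.div_rpow hT (by positivity), ← Real.rpow_natCast, ← Real.rpow_natCast,
    ← Real.rpow_mul (by norm_num), ← Real.rpow_mul (by norm_num), mul_div_left_comm,
    ← Real.rpow_sub (by norm_num)]
  congr 2
  ring

theorem min_dyadic_sub_le (n k : ℕ) (hT : 0 ≤ T) (t : ℝ) :
    min (dyadicPoint T n (k + 1)) t - min (dyadicPoint T n k) t ≤ T / 2 ^ n := by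
  rw [← dyadicPoint_succ_sub n k]
  have := dyadicPoint_mono hT n (Nat.le_succ k)
  simp only [Nat.succ_eq_add_one] at this
  rcases min_cases (dyadicPoint T n (k + 1)) t with h1 | h1 <;>
  rcases min_cases (dyadicPoint T n k) t with h2 | h2 <;> linarith

theorem IsAlmostAdditive.norm_dyadicSum_succ_sub_le (h : IsAlmostAdditive C θ T Ξ) (hC : 0 ≤ C)
    (hθ : 1 < θ) (n : ℕ) {t : ℝ} (ht : 0 ≤ t) (htT : t ≤ T) :
    ‖dyadicSum T Ξ n t - dyadicSum T Ξ (n + 1) t‖ ≤ C * T ^ θ * ((2 : ℝ) ^ (1 - θ)) ^ n := by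
  have hT : 0 ≤ T := ht.trans htT
  unfold dyadicSum
  rw [pow_succ', sum_range_two_mul, ← Finset.sum_sub_distrib]
  refine (norm_sum_le_of_le _ (f := _) (n := fun _ => C * (T / 2 ^ n) ^ θ) ?_).trans ?_
  · intro k _
    rw [dyadicPoint_succ_two_mul, show 2 * k + 1 + 1 = 2 * (k + 1) by ring,
      dyadicPoint_succ_two_mul, ← sub_sub]
    have m1 := dyadicPoint_mono hT (n + 1) (Nat.le_succ (2 * k))
    have m2 := dyadicPoint_mono hT (n + 1) (Nat.le_succ (2 * k + 1))
    simp only [Nat.succ_eq_add_one, show 2 * k + 1 + 1 = 2 * (k + 1) by ring,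
      dyadicPoint_succ_two_mul] at m1 m2
    have m0 := dyadicPoint_mono hT n (Nat.zero_le k)
    rw [dyadicPoint_zero] at m0
    refine (h _ _ _ (le_min m0 ht) (min_le_min_right _ m1) (min_le_min_right _ m2)
      ((min_le_right _ _).trans htT)).trans ?_
    refine mul_le_mul_of_nonneg_left (Real.rpow_le_rpow ?_ (min_dyadic_sub_le n k hT t)
      (by linarith)) hC
    exact sub_nonneg.2 (min_le_min_right _ (m1.trans m2))
  · rw [Finset.sum_const, Finset.card_range, nsmul_eq_mul]
    push_cast
    rw [mul_left_comm, two_pow_mul_mesh hT, mul_assoc]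

/-- Subtracting the sums truncated at t and at s leaves the Riemann sum over the dyadic points
clipped to [s, t], except for the defect in an interval straddling s. The maximal inequality handles
the clipped sum; the defect disappears as n → ∞. -/
theorem IsAlmostAdditive.norm_dyadicSum_sub_le (h : IsAlmostAdditive C θ T Ξ) (hC : 0 ≤ C)
    (hθ : 1 < θ) (n : ℕ) {s t : ℝ} (hs : 0 ≤ s) (hst : s ≤ t) (htT : t ≤ T) :
    ‖dyadicSum T Ξ n t - dyadicSum T Ξ n s - Ξ s t‖
      ≤ C * T ^ θ * ((2 : ℝ) ^ (1 - θ)) ^ n + 2 * C / (1 - 2 ^ (1 - θ)) * (t - s) ^ θ := by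
  have hT : 0 ≤ T := (hs.trans hst).trans htT
  set a := dyadicPoint T n with ha
  set p : ℕ → ℝ := fun k => max (min (a k) t) s with hp
  have pm : Monotone p := fun i j hij =>
    max_le_max_right _ (min_le_min_right _ (dyadicPoint_mono hT n hij))
  have p0 : p 0 = s := by
    simp only [hp, ha, dyadicPoint_zero]
    rw [min_eq_left (by linarith), max_eq_right hs]
  have pn : p (2 ^ n) = t := by
    simp only [hp, ha, dyadicPoint_last]
    rw [min_eq_right htT, max_eq_left hst]
  have h1 := h.norm_sum_sub_le hC hθ (2 ^ n) p pm (by rw [p0]; exact hs) (by rw [pn]; exact htT)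
  rw [p0, pn] at h1
  have h2 : ‖dyadicSum T Ξ n t - dyadicSum T Ξ n s
      - ∑ k ∈ Finset.range (2 ^ n), Ξ (p k) (p (k + 1))‖
      ≤ C * T ^ θ * ((2 : ℝ) ^ (1 - θ)) ^ n := by
    unfold dyadicSum
    rw [← Finset.sum_sub_distrib, ← Finset.sum_sub_distrib]
    refine (norm_sum_le_of_le _ (f := _) (n := fun _ => C * (T / 2 ^ n) ^ θ) ?_).trans ?_
    -- A dyadic interval on one side of s contributes 0. The one-defect bound is nevertheless used
    -- for all 2^n intervals, since the total still tends to 0.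
    · intro k _
      have m := dyadicPoint_mono hT n (Nat.le_succ k)
      have m0 := dyadicPoint_mono hT n (Nat.zero_le k)
      have m1 := min_dyadic_sub_le n k hT t
      rw [dyadicPoint_zero] at m0
      have hpos : 0 ≤ C * (T / 2 ^ n) ^ θ := by positivity
      simp only [hp, ← ha, Nat.succ_eq_add_one] at m m0 m1 ⊢
      have main : ∀ {x y : ℝ}, 0 ≤ x → x ≤ s → s ≤ y → y ≤ t → y - x ≤ T / 2 ^ n →
          ‖Ξ x y - Ξ x s - Ξ s y‖ ≤ C * (T / 2 ^ n) ^ θ := fun hx hxs hsy hyt hxy =>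
        (h _ _ _ hx hxs hsy (hyt.trans htT)).trans (mul_le_mul_of_nonneg_left
          (Real.rpow_le_rpow (by linarith) hxy (by linarith)) hC)
      rcases le_total (a (k + 1)) s with c1 | c1
      · rw [min_eq_left (m.trans (c1.trans hst)), min_eq_left (c1.trans hst),
          min_eq_left (m.trans c1), min_eq_left c1, max_eq_right c1, max_eq_right (m.trans c1),
          h.diag hθ hs (hst.trans htT)]
        simpa using hpos
      · rcases le_total (a k) s with c2 | c2
        · rw [min_eq_left (c2.trans hst)] at m1 ⊢
          rw [min_eq_left c2, min_eq_right c1, max_eq_right c2, max_eq_left (le_min c1 hst)]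
          exact main m0 c2 (le_min c1 hst) (min_le_right _ _) m1
        · rw [min_eq_right c1, min_eq_right c2, max_eq_left (le_min c1 hst),
            max_eq_left (le_min c2 hst), h.diag hθ hs (hst.trans htT)]
          simpa using hpos
    · rw [Finset.sum_const, Finset.card_range, nsmul_eq_mul]
      push_cast
      rw [mul_left_comm, two_pow_mul_mesh hT, mul_assoc]
  calc _ ≤ _ := norm_sub_le_norm_sub_add_norm_sub _ (∑ k ∈ Finset.range (2 ^ n), Ξ (p k) (p (k + 1))) _
    _ ≤ _ := add_le_add h2 h1

/-- The sewing lemma. -/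
theorem IsAlmostAdditive.exists_path [CompleteSpace K] (h : IsAlmostAdditive C θ T Ξ) (hC : 0 ≤ C)
    (hθ : 1 < θ) : ∃ J : ℝ → K, ∃ M : ℝ, 0 ≤ M ∧ ∀ s t, 0 ≤ s → s ≤ t → t ≤ T →
      ‖J t - J s - Ξ s t‖ ≤ M * (t - s) ^ θ := by
  have hq := two_rpow_one_sub_lt_one hθ
  have hlim : ∀ t, ∃ I, 0 ≤ t → t ≤ T →
      Filter.Tendsto (fun n => dyadicSum T Ξ n t) Filter.atTop (nhds I) := by
    intro t
    by_cases ht : 0 ≤ t ∧ t ≤ T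
    · have hc : CauchySeq fun n => dyadicSum T Ξ n t := by
        refine cauchySeq_of_le_geometric _ (C * T ^ θ) hq fun n => ?_
        rw [dist_eq_norm]
        exact h.norm_dyadicSum_succ_sub_le hC hθ n ht.1 ht.2
      obtain ⟨I, hI⟩ := cauchySeq_tendsto_of_complete hc
      exact ⟨I, fun _ _ => hI⟩
    -- An arbitrary value off [0, T], so that `choose` yields a path on all of ℝ.
    · exact ⟨0, fun h1 h2 => absurd ⟨h1, h2⟩ ht⟩
  choose J hJ using hlim
  refine ⟨J, 2 * C / (1 - 2 ^ (1 - θ)), div_nonneg (by positivity) (by linarith), ?_⟩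
  intro s t hs hst ht
  have t1 := (((hJ t (hs.trans hst) ht).sub (hJ s hs (hst.trans ht))).sub_const (Ξ s t)).norm
  have t2 : Filter.Tendsto (fun n : ℕ => C * T ^ θ * ((2 : ℝ) ^ (1 - θ)) ^ n
      + 2 * C / (1 - 2 ^ (1 - θ)) * (t - s) ^ θ) Filter.atTop
      (nhds (C * T ^ θ * 0 + 2 * C / (1 - 2 ^ (1 - θ)) * (t - s) ^ θ)) :=
    ((tendsto_pow_atTop_nhds_zero_of_lt_one (by positivity) hq).const_mul _).add_const _
  have := le_of_tendsto_of_tendsto' t1 t2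
    fun n => h.norm_dyadicSum_sub_le hC hθ n hs hst ht
  simpa using this

end Sewing

/-! ### Calculus of Riemann limits -/

section Limits

variable {K : Type*} [NormedAddCommGroup K] {Ξ Ξ' : ℝ → ℝ → K} {s t T : ℝ} {I I' : K}

theorem IsPartition.mono {δ δ' : ℝ} {n : ℕ} {p : ℕ → ℝ} (h : IsPartition s t δ n p)
    (hδ : δ ≤ δ') : IsPartition s t δ' n p :=
  ⟨h.1, h.2.1, fun k hk => ⟨(h.2.2 k hk).1, (h.2.2 k hk).2.trans_le hδ⟩⟩

theorem IsPartition.le_of_le {δ : ℝ} {n : ℕ} {p : ℕ → ℝ} (h : IsPartition s t δ n p) {i j : ℕ}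
    (hij : i ≤ j) (hj : j ≤ n) : p i ≤ p j := by
  induction j, hij using Nat.le_induction with
  | base => rfl
  | succ j hij ih => exact (ih (by omega)).trans (h.2.2 j (by omega)).1.le

/-- Partitions of arbitrarily small mesh exist, so `IsRiemannLim` is not vacuous and its limits are
unique. For s = t the empty partition is needed, because steps must be strictly positive. -/
theorem exists_isPartition (hst : s ≤ t) {δ : ℝ} (hδ : 0 < δ) :
    ∃ n p, IsPartition s t δ n p := by
  rcases hst.eq_or_lt with rfl | hlt
  · exact ⟨0, fun _ => s, rfl, rfl, fun k hk => absurd hk (Nat.not_lt_zero k)⟩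
  obtain ⟨n, hn⟩ := exists_nat_gt ((t - s) / δ)
  have hn0 : (0 : ℝ) < n := (div_pos (sub_pos.2 hlt) hδ).trans hn
  have hstep : (t - s) / n < δ := by
    rw [div_lt_iff₀ hδ] at hn
    rw [div_lt_iff₀ hn0]
    linarith
  have hpos : 0 < (t - s) / n := div_pos (sub_pos.2 hlt) hn0
  refine ⟨n, fun k => s + k * ((t - s) / n), by simp, ?_, fun k _ => ?_⟩
  · field_simp
    ring
  · push_cast
    constructor <;> linarith

theorem IsRiemannLim.unique (hst : s ≤ t) (h : IsRiemannLim Ξ s t I) (h' : IsRiemannLim Ξ s t I') :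
    I = I' := by
  by_contra hne
  have hε : 0 < ‖I - I'‖ / 2 := half_pos (norm_pos_iff.2 (sub_ne_zero.2 hne))
  obtain ⟨δ, hδ, H⟩ := h _ hε
  obtain ⟨δ', hδ', H'⟩ := h' _ hε
  obtain ⟨n, p, hp⟩ := exists_isPartition hst (lt_min hδ hδ')
  have h1 := H n p (hp.mono (min_le_left _ _))
  have h2 := H' n p (hp.mono (min_le_right _ _))
  rw [norm_sub_rev] at h1
  have := norm_sub_le_norm_sub_add_norm_sub I (∑ k ∈ Finset.range n, Ξ (p k) (p (k + 1))) I'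
  linarith

theorem IsRiemannLim.add (h : IsRiemannLim Ξ s t I) (h' : IsRiemannLim Ξ' s t I') :
    IsRiemannLim (fun u v => Ξ u v + Ξ' u v) s t (I + I') := by
  intro ε hε
  obtain ⟨δ, hδ, H⟩ := h _ (half_pos hε)
  obtain ⟨δ', hδ', H'⟩ := h' _ (half_pos hε)
  refine ⟨_, lt_min hδ hδ', fun n p hp => ?_⟩
  have h1 := H n p (hp.mono (min_le_left _ _))
  have h2 := H' n p (hp.mono (min_le_right _ _))
  rw [Finset.sum_add_distrib, add_sub_add_comm]
  exact (norm_add_le _ _).trans_lt (by linarith)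

theorem IsRiemannLim.neg (h : IsRiemannLim Ξ s t I) :
    IsRiemannLim (fun u v => -Ξ u v) s t (-I) := by
  intro ε hε
  obtain ⟨δ, hδ, H⟩ := h _ hε
  refine ⟨δ, hδ, fun n p hp => ?_⟩
  have h1 := H n p hp
  rwa [Finset.sum_neg_distrib, ← neg_sub', norm_neg]

theorem IsRiemannLim.sub (h : IsRiemannLim Ξ s t I) (h' : IsRiemannLim Ξ' s t I') :
    IsRiemannLim (fun u v => Ξ u v - Ξ' u v) s t (I - I') := by
  simpa only [sub_eq_add_neg] using h.add h'.neg

theorem IsRiemannLim.const_smul [NormedSpace ℝ K] (h : IsRiemannLim Ξ s t I) {c : ℝ}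
    (hc : c ≠ 0) : IsRiemannLim (fun u v => c • Ξ u v) s t (c • I) := by
  intro ε hε
  have hc' : 0 < ‖c‖ := norm_pos_iff.2 hc
  obtain ⟨δ, hδ, H⟩ := h _ (div_pos hε hc')
  refine ⟨δ, hδ, fun n p hp => ?_⟩
  have h1 := H n p hp
  rwa [← Finset.smul_sum, ← smul_sub, norm_smul, ← lt_div_iff₀' hc']

/-- A germ that is close to the increments of a path has these increments as Riemann limits. -/
theorem isRiemannLim_of_close {J : ℝ → K} {M θ : ℝ} (hM : 0 ≤ M) (hθ : 1 < θ)
    (h : ∀ s t, 0 ≤ s → s ≤ t → t ≤ T → ‖J t - J s - Ξ s t‖ ≤ M * (t - s) ^ θ)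
    (hs : 0 ≤ s) (ht : t ≤ T) : IsRiemannLim Ξ s t (J t - J s) := by
  intro ε hε
  have hθ' : 0 < θ - 1 := by linarith
  -- An interval of length h < δ has error M h^θ ≤ M δ^(θ-1) h, and the lengths h add up to t - s.
  obtain ⟨δ, hδ, hδε⟩ : ∃ δ > 0, M * δ ^ (θ - 1) * (t - s) < ε := by
    have hc : Filter.Tendsto (fun δ : ℝ => M * δ ^ (θ - 1) * (t - s)) (nhdsWithin 0 (Set.Ioi 0))
        (nhds (M * 0 ^ (θ - 1) * (t - s))) := by
      refine Filter.Tendsto.mono_left ?_ nhdsWithin_le_nhds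
      exact (((Real.continuousAt_rpow_const _ _ (Or.inr hθ'.le)).tendsto.const_mul M).mul_const _)
    rw [Real.zero_rpow hθ'.ne', mul_zero, zero_mul] at hc
    obtain ⟨δ, h1, h2⟩ := ((hc.eventually_lt_const hε).and self_mem_nhdsWithin).exists
    exact ⟨δ, h2, h1⟩
  refine ⟨δ, hδ, fun n p hp => ?_⟩
  have htel : J t - J s = ∑ k ∈ Finset.range n, (J (p (k + 1)) - J (p k)) := by
    rw [Finset.sum_range_sub (fun k => J (p k)), hp.1, hp.2.1]
  have htel' : t - s = ∑ k ∈ Finset.range n, (p (k + 1) - p k) := by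
    rw [Finset.sum_range_sub, hp.1, hp.2.1]
  rw [htel, norm_sub_rev, ← Finset.sum_sub_distrib]
  refine lt_of_le_of_lt ?_ hδε
  rw [htel', Finset.mul_sum]
  refine norm_sum_le_of_le _ fun k hk => ?_
  have hk := Finset.mem_range.1 hk
  obtain ⟨hk1, hk2⟩ := hp.2.2 k hk
  have a1 : s ≤ p k := by rw [← hp.1]; exact hp.le_of_le (Nat.zero_le k) hk.le
  have a2 : p (k + 1) ≤ t := by rw [← hp.2.1]; exact hp.le_of_le hk le_rfl
  refine (h _ _ (hs.trans a1) hk1.le (a2.trans ht)).trans ?_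
  have hpos : 0 < p (k + 1) - p k := by linarith
  rw [mul_assoc]
  refine mul_le_mul_of_nonneg_left ?_ hM
  calc (p (k + 1) - p k) ^ θ = (p (k + 1) - p k) ^ (θ - 1) * (p (k + 1) - p k) := by
        rw [← Real.rpow_add_one hpos.ne', sub_add_cancel]
    _ ≤ δ ^ (θ - 1) * (p (k + 1) - p k) := by
        gcongr

/-- All the integrals over subintervals of `[0,T]` with germ `Ξ` exist and are the increments of
`J`. -/
def IsIntegralPath (T : ℝ) (Ξ : ℝ → ℝ → K) (J : ℝ → K) : Prop :=
  ∀ s t, 0 ≤ s → s ≤ t → t ≤ T → IsRiemannLim Ξ s t (J t - J s)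

theorem isIntegralPath_sub (T : ℝ) (P : ℝ → K) : IsIntegralPath T (fun u v => P v - P u) P :=
  fun _ _ hs _ ht => isRiemannLim_of_close (M := 0) (θ := 2) le_rfl (by norm_num)
    (fun _ _ _ _ _ => by simp) hs ht

theorem IsRiemannLim.germInt_eq (hst : s ≤ t) (h : IsRiemannLim Ξ s t I) : germInt Ξ s t = I := by
  have hex : RiemannLimExists Ξ s t := ⟨I, h⟩
  rw [germInt, if_pos hst, riemannLim, dif_pos hex]
  exact hex.choose_spec.unique hst h

theorem IsIntegralPath.germInt_eq {J : ℝ → K} (h : IsIntegralPath T Ξ J) (hs : s ∈ Set.Icc 0 T)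
    (ht : t ∈ Set.Icc 0 T) : germInt Ξ s t = J t - J s := by
  rcases le_total s t with hst | hst
  · exact (h s t hs.1 hst ht.2).germInt_eq hst
  · rcases hst.eq_or_lt with rfl | hlt
    · exact (h _ _ hs.1 le_rfl ht.2).germInt_eq le_rfl
    · have := (h t s ht.1 hst hs.2).germInt_eq hst
      rw [germInt, if_pos hst] at this
      rw [germInt, if_neg hlt.not_ge, this, neg_sub]

end Limits

/-! ### Operators on the projective tensor product -/

section ProjectiveTensor

variable {E F G : Type*} [NormedAddCommGroup E] [NormedSpace ℝ E]
  [NormedAddCommGroup F] [NormedSpace ℝ F] [NormedAddCommGroup G] [NormedSpace ℝ G]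

theorem ptmulL_apply (x : E) (y : F) : ptmulL E F x y = ptmul x y := rfl

/-- A bounded operator on `E ⊗ F` is determined by its values on elementary tensors. -/
theorem projTensor_ext {A B : ProjTensor E F →L[ℝ] G}
    (h : ∀ x y, A (ptmul x y) = B (ptmul x y)) : A = B := by
  ext z
  induction z using UniformSpace.Completion.induction_on with
  | hp => exact isClosed_eq A.continuous B.continuous
  | ih z =>
    obtain ⟨l, rfl⟩ := exists_tensorSum z
    induction l with
    | nil =>
      have : ((tensorSum ([] : List (E × F)) : AlgTensor E F) : ProjTensor E F) = 0 :=
        UniformSpace.Completion.coe_zero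
      rw [this, map_zero, map_zero]
    | cons p l ih =>
      have : ((tensorSum (p :: l) : AlgTensor E F) : ProjTensor E F)
          = ptmul p.1 p.2 + ((tensorSum l : AlgTensor E F) : ProjTensor E F) := by
        rw [ptmul, ← UniformSpace.Completion.coe_add]
        rfl
      rw [this, map_add, map_add, ih, h]

theorem eq_plift [CompleteSpace G] {A : ProjTensor E F →L[ℝ] G} {B : E →L[ℝ] F →L[ℝ] G}
    (h : ∀ x y, A (ptmul x y) = B x y) : A = plift B :=
  projTensor_ext fun x y => by rw [h, plift_ptmul]

theorem pswap_ptmul (x y : E) : pswap E (ptmul x y) = ptmul y x := plift_ptmul _ x y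

/-- Transposing the second level amounts to exchanging the arguments of the bilinear map; this is
what turns ∫ dQ(P) into an integral of the other type. -/
theorem plift_pswap [CompleteSpace G] (B : E →L[ℝ] E →L[ℝ] G) (z : ProjTensor E E) :
    plift B (pswap E z) = plift B.flip z := by
  have : (plift B).comp (pswap E) = plift B.flip := eq_plift fun x y => by
    rw [ContinuousLinearMap.comp_apply, pswap_ptmul, plift_ptmul, ContinuousLinearMap.flip_apply]
  rw [← this, ContinuousLinearMap.comp_apply]

theorem plift_sub [CompleteSpace G] (B C : E →L[ℝ] F →L[ℝ] G) :
    plift (B - C) = plift B - plift C :=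
  (eq_plift fun x y => by simp [plift_ptmul]).symm

theorem norm_plift_le [CompleteSpace G] (B : E →L[ℝ] F →L[ℝ] G) (z : ProjTensor E F) :
    ‖plift B z‖ ≤ ‖B‖ * ‖z‖ := by
  induction z using UniformSpace.Completion.induction_on with
  | hp => exact isClosed_le (by fun_prop) (by fun_prop)
  | ih z =>
    have h := ContinuousLinearMap.extend_eq (algLift B)
      (e := (UniformSpace.Completion.toComplL : AlgTensor E F →L[ℝ] ProjTensor E F))
      UniformSpace.Completion.denseRange_coe (UniformSpace.Completion.isUniformInducing_coe _) z
    have h' : plift B (z : ProjTensor E F) = algLiftLin B z := h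
    rw [h', UniformSpace.Completion.norm_coe]
    exact norm_lift_le B z

end ProjectiveTensor

/-! ### Functions of order `|t - s|^γ` -/

section Orders

set_option linter.unusedSectionVars false

variable {E F G : Type*} [NormedAddCommGroup E] [NormedSpace ℝ E]
  [NormedAddCommGroup F] [NormedSpace ℝ F] [NormedAddCommGroup G] [NormedSpace ℝ G]
  {T γ δ : ℝ}

/-- `f s u t = O(|t - s|^γ)` for `0 ≤ s ≤ u ≤ t ≤ T`. -/
def HasOrder (T γ : ℝ) (f : ℝ → ℝ → ℝ → E) : Prop :=
  ∃ C, 0 ≤ C ∧ ∀ s u t, 0 ≤ s → s ≤ u → u ≤ t → t ≤ T → ‖f s u t‖ ≤ C * (t - s) ^ γ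

variable {f g : ℝ → ℝ → ℝ → E}

theorem HasOrder.of_eq (h : HasOrder T γ f) (hγ : γ = δ) : HasOrder T δ f := hγ ▸ h

theorem HasOrder.congr (h : HasOrder T γ f)
    (hfg : ∀ s u t, 0 ≤ s → s ≤ u → u ≤ t → t ≤ T → g s u t = f s u t) : HasOrder T γ g := by
  obtain ⟨C, hC, H⟩ := h
  exact ⟨C, hC, fun s u t h1 h2 h3 h4 => by rw [hfg s u t h1 h2 h3 h4]; exact H s u t h1 h2 h3 h4⟩

theorem HasOrder.of_norm_le {g : ℝ → ℝ → ℝ → F} (h : HasOrder T γ f) (M : ℝ)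
    (hfg : ∀ s u t, 0 ≤ s → s ≤ u → u ≤ t → t ≤ T → ‖g s u t‖ ≤ M * ‖f s u t‖) :
    HasOrder T γ g := by
  obtain ⟨C, hC, H⟩ := h
  refine ⟨|M| * C, by positivity, fun s u t h1 h2 h3 h4 => (hfg s u t h1 h2 h3 h4).trans ?_⟩
  rw [mul_assoc]
  exact mul_le_mul (le_abs_self M) (H s u t h1 h2 h3 h4) (norm_nonneg _) (abs_nonneg _)

theorem HasOrder.add (hf : HasOrder T γ f) (hg : HasOrder T γ g) :
    HasOrder T γ fun s u t => f s u t + g s u t := by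
  obtain ⟨C, hC, H⟩ := hf
  obtain ⟨D, hD, H'⟩ := hg
  refine ⟨C + D, by positivity, fun s u t h1 h2 h3 h4 => ?_⟩
  rw [add_mul]
  exact (norm_add_le _ _).trans (add_le_add (H s u t h1 h2 h3 h4) (H' s u t h1 h2 h3 h4))

theorem HasOrder.neg (hf : HasOrder T γ f) : HasOrder T γ fun s u t => -f s u t :=
  hf.of_norm_le 1 fun _ _ _ _ _ _ _ => by rw [norm_neg, one_mul]

theorem HasOrder.sub (hf : HasOrder T γ f) (hg : HasOrder T γ g) :
    HasOrder T γ fun s u t => f s u t - g s u t := by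
  simpa only [sub_eq_add_neg] using hf.add hg.neg

theorem HasOrder.const_smul (c : ℝ) (hf : HasOrder T γ f) :
    HasOrder T γ fun s u t => c • f s u t :=
  hf.of_norm_le ‖c‖ fun _ _ _ _ _ _ _ => by rw [norm_smul]

theorem HasOrder.mono (hT : 0 ≤ T) (hγ : 0 ≤ γ) (h : γ ≤ δ)
    (hf' : HasOrder T δ g) : HasOrder T γ g := by
  obtain ⟨C, hC, H⟩ := hf'
  refine ⟨C * T ^ (δ - γ), by positivity, fun s u t h1 h2 h3 h4 =>
    (H s u t h1 h2 h3 h4).trans ?_⟩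
  rw [mul_assoc]
  refine mul_le_mul_of_nonneg_left ?_ hC
  have h0 : 0 ≤ t - s := by linarith
  calc (t - s) ^ δ = (t - s) ^ (δ - γ + γ) := by rw [sub_add_cancel]
    _ = (t - s) ^ (δ - γ) * (t - s) ^ γ := Real.rpow_add_of_nonneg h0 (by linarith) hγ
    _ ≤ _ := mul_le_mul_of_nonneg_right
      (Real.rpow_le_rpow h0 (by linarith) (by linarith)) (by positivity)

/-- The product rule for orders, for a product with `‖f g‖ ≤ M ‖f‖ ‖g‖`. -/
theorem HasOrder.mul_of_norm_le {f : ℝ → ℝ → ℝ → E} {g : ℝ → ℝ → ℝ → F} {h : ℝ → ℝ → ℝ → G}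
    (hf : HasOrder T γ f) (hg : HasOrder T δ g) (hγ : 0 ≤ γ) (hδ : 0 ≤ δ) (M : ℝ)
    (H : ∀ s u t, ‖h s u t‖ ≤ M * (‖f s u t‖ * ‖g s u t‖)) : HasOrder T (γ + δ) h := by
  obtain ⟨C, hC, Hf⟩ := hf
  obtain ⟨D, hD, Hg⟩ := hg
  refine ⟨|M| * (C * D), by positivity, fun s u t h1 h2 h3 h4 => (H s u t).trans ?_⟩
  have h0 : 0 ≤ t - s := by linarith
  rw [Real.rpow_add_of_nonneg h0 hγ hδ]
  calc M * (‖f s u t‖ * ‖g s u t‖) ≤ |M| * (‖f s u t‖ * ‖g s u t‖) :=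
        mul_le_mul_of_nonneg_right (le_abs_self M) (by positivity)
    _ ≤ |M| * ((C * (t - s) ^ γ) * (D * (t - s) ^ δ)) :=
        mul_le_mul_of_nonneg_left (mul_le_mul (Hf s u t h1 h2 h3 h4) (Hg s u t h1 h2 h3 h4)
          (norm_nonneg _) (by positivity)) (abs_nonneg _)
    _ = _ := by ring

theorem HasOrder.clm_apply {A : ℝ → ℝ → ℝ → E →L[ℝ] F} (hA : HasOrder T γ A)
    (hf : HasOrder T δ f) (hγ : 0 ≤ γ) (hδ : 0 ≤ δ) :
    HasOrder T (γ + δ) fun s u t => A s u t (f s u t) :=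
  hA.mul_of_norm_le hf hγ hδ 1 fun _ _ _ => by
    rw [one_mul]
    exact ContinuousLinearMap.le_opNorm _ _

theorem HasOrder.clm_comp (L : E →L[ℝ] F) (hf : HasOrder T γ f) :
    HasOrder T γ fun s u t => L (f s u t) :=
  hf.of_norm_le ‖L‖ fun _ _ _ _ _ _ _ => L.le_opNorm _

theorem HasOrder.plift_apply [CompleteSpace G] {B : ℝ → ℝ → ℝ → E →L[ℝ] F →L[ℝ] G}
    {z : ℝ → ℝ → ℝ → ProjTensor E F} (hB : HasOrder T γ B) (hz : HasOrder T δ z) (hγ : 0 ≤ γ)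
    (hδ : 0 ≤ δ) : HasOrder T (γ + δ) fun s u t => plift (B s u t) (z s u t) :=
  hB.mul_of_norm_le hz hγ hδ 1 fun _ _ _ => by
    rw [one_mul]
    exact norm_plift_le _ _

/-- Since u - s ≤ t - s and γ ≥ 0, bounds over [s, u] may be measured by the full interval. With
`HasOrder.right`, this lets all factors of a defect be compared on one scale. -/
theorem HasOrder.left {f : ℝ → ℝ → E} (hγ : 0 ≤ γ) (hf : HasOrder T γ fun s _ t => f s t) :
    HasOrder T γ fun s u _ => f s u := by
  obtain ⟨C, hC, H⟩ := hf
  refine ⟨C, hC, fun s u t h1 h2 h3 h4 => (H s s u h1 le_rfl h2 (h3.trans h4)).trans ?_⟩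
  exact mul_le_mul_of_nonneg_left (Real.rpow_le_rpow (by linarith) (by linarith) hγ) hC

theorem HasOrder.right {f : ℝ → ℝ → E} (hγ : 0 ≤ γ) (hf : HasOrder T γ fun s _ t => f s t) :
    HasOrder T γ fun _ u t => f u t := by
  obtain ⟨C, hC, H⟩ := hf
  refine ⟨C, hC, fun s u t h1 h2 h3 h4 => (H u u t (h1.trans h2) le_rfl h3 h4).trans ?_⟩
  exact mul_le_mul_of_nonneg_left (Real.rpow_le_rpow (by linarith) (by linarith) hγ) hC

theorem HasOrder.of_bound {P : ℝ → E} (M : ℝ) (h : ∀ t ∈ Set.Icc 0 T, ‖P t‖ ≤ M) :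
    HasOrder T 0 fun s _ _ => P s :=
  ⟨|M|, abs_nonneg _, fun s u t h1 h2 h3 h4 => by
    rw [Real.rpow_zero, mul_one]
    exact (h s ⟨h1, by linarith⟩).trans (le_abs_self M)⟩

theorem HasOrder.of_bound_right {P : ℝ → E} (M : ℝ) (h : ∀ t ∈ Set.Icc 0 T, ‖P t‖ ≤ M) :
    HasOrder T 0 fun _ _ t => P t :=
  ⟨|M|, abs_nonneg _, fun s u t h1 h2 h3 h4 => by
    rw [Real.rpow_zero, mul_one]
    exact (h t ⟨by linarith, by linarith⟩).trans (le_abs_self M)⟩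

/-- `IsHolderTwo` says nothing about s = t, whereas `HasOrder` includes it; hence the separate
condition on the diagonal. -/
theorem IsHolderTwo.hasOrder {f : ℝ → ℝ → E} (h : IsHolderTwo γ T f)
    (h0 : ∀ t ∈ Set.Icc 0 T, f t t = 0) : HasOrder T γ fun s _ t => f s t := by
  obtain ⟨C, H⟩ := h
  refine ⟨|C|, abs_nonneg _, fun s u t h1 h2 h3 h4 => ?_⟩
  have hs : s ∈ Set.Icc 0 T := ⟨h1, by linarith⟩
  have hpos : 0 ≤ t - s := by linarith
  by_cases hst : s = t
  · subst hst
    simp only [h0 s hs, norm_zero]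
    positivity
  · refine (H s hs t ⟨by linarith, h4⟩ hst).trans ?_
    rw [abs_of_nonneg hpos]
    exact mul_le_mul_of_nonneg_right (le_abs_self C) (by positivity)

theorem IsHolder.hasOrder {P : ℝ → E} (h : IsHolder γ T P) :
    HasOrder T γ fun s _ t => P t - P s :=
  IsHolderTwo.hasOrder (f := fun s t => P t - P s) h fun _ _ => sub_self _

/-- To be `γ`-Hölder it is enough to be so for `s ≤ t`, in both orders of the arguments. -/
theorem isHolderTwo_of_hasOrder {f : ℝ → ℝ → E} (h : HasOrder T γ fun s _ t => f s t)
    (h' : HasOrder T γ fun s _ t => f t s) : IsHolderTwo γ T f := by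
  obtain ⟨C, hC, H⟩ := h
  obtain ⟨D, hD, H'⟩ := h'
  refine ⟨max C D, fun s hs t ht _ => ?_⟩
  rcases le_total s t with hst | hst
  · rw [abs_of_nonneg (sub_nonneg.2 hst)]
    exact (H s s t hs.1 le_rfl hst ht.2).trans
      (mul_le_mul_of_nonneg_right (le_max_left _ _) (Real.rpow_nonneg (sub_nonneg.2 hst) _))
  · rw [abs_sub_comm, abs_of_nonneg (sub_nonneg.2 hst)]
    exact (H' t t s ht.1 le_rfl hst hs.2).trans
      (mul_le_mul_of_nonneg_right (le_max_right _ _) (Real.rpow_nonneg (sub_nonneg.2 hst) _))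

theorem isHolder_of_hasOrder {P : ℝ → E} (h : HasOrder T γ fun s _ t => P t - P s) :
    IsHolder γ T P :=
  isHolderTwo_of_hasOrder (f := fun s t => P t - P s) h
    (h.neg.congr fun _ _ _ _ _ _ _ => (neg_sub _ _).symm)

theorem IsHolder.exists_bound {P : ℝ → E} (hγ : 0 ≤ γ) (h : IsHolder γ T P) :
    ∃ M, ∀ t ∈ Set.Icc 0 T, ‖P t‖ ≤ M := by
  obtain ⟨C, hC, H⟩ := h.hasOrder
  refine ⟨C * T ^ γ + ‖P 0‖, fun t ht => ?_⟩
  have := H 0 0 t le_rfl le_rfl ht.1 ht.2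
  calc ‖P t‖ = ‖(P t - P 0) + P 0‖ := by rw [sub_add_cancel]
    _ ≤ ‖P t - P 0‖ + ‖P 0‖ := norm_add_le _ _
    _ ≤ _ := by
      gcongr
      refine this.trans (mul_le_mul_of_nonneg_left ?_ hC)
      rw [sub_zero]
      exact Real.rpow_le_rpow ht.1 ht.2 hγ

theorem IsHolder.hasOrder_zero {P : ℝ → E} (hγ : 0 ≤ γ) (h : IsHolder γ T P) :
    HasOrder T 0 fun s _ _ => P s :=
  let ⟨M, hM⟩ := h.exists_bound hγ
  HasOrder.of_bound M hM

theorem IsHolder.hasOrder_zero_right {P : ℝ → E} (hγ : 0 ≤ γ) (h : IsHolder γ T P) :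
    HasOrder T 0 fun _ _ t => P t :=
  let ⟨M, hM⟩ := h.exists_bound hγ
  HasOrder.of_bound_right M hM

theorem IsHolder.clm_comp {P : ℝ → E} (h : IsHolder γ T P) (L : E →L[ℝ] F) :
    IsHolder γ T fun t => L (P t) :=
  isHolder_of_hasOrder ((h.hasOrder.clm_comp L).congr fun _ _ _ _ _ _ _ => (map_sub L _ _).symm)

theorem IsHolder.add {P Q : ℝ → E} (hP : IsHolder γ T P) (hQ : IsHolder γ T Q) :
    IsHolder γ T fun t => P t + Q t :=
  isHolder_of_hasOrder ((hP.hasOrder.add hQ.hasOrder).congr fun _ _ _ _ _ _ _ => by abel)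

theorem IsHolder.clm_apply {A : ℝ → E →L[ℝ] F} {P : ℝ → E} (hγ : 0 ≤ γ)
    (hA : IsHolder γ T A) (hP : IsHolder γ T P) : IsHolder γ T fun t => A t (P t) := by
  refine isHolder_of_hasOrder ?_
  have h1 := hA.hasOrder.clm_apply (hP.hasOrder_zero_right hγ) hγ le_rfl
  have h2 := (hA.hasOrder_zero hγ).clm_apply hP.hasOrder le_rfl hγ
  rw [add_zero] at h1
  rw [zero_add] at h2
  exact (h1.add h2).congr fun s u t _ _ _ _ => by
    simp only [map_sub, sub_apply]; abel

/-- If the increment of a germ over `s ≤ u ≤ t` has order `γ > 1`, then the germ can be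
integrated. -/
theorem HasOrder.exists_integralPath [CompleteSpace E] {Ξ : ℝ → ℝ → E} (hγ : 1 < γ)
    (h : HasOrder T γ fun s u t => Ξ s t - Ξ s u - Ξ u t) :
    ∃ J, IsIntegralPath T Ξ J ∧ HasOrder T γ fun s _ t => J t - J s - Ξ s t := by
  obtain ⟨C, hC, H⟩ := h
  obtain ⟨J, M, hM, hJ⟩ := IsAlmostAdditive.exists_path (Ξ := Ξ) (T := T) H hC hγ
  exact ⟨J, fun s t hs _ ht => isRiemannLim_of_close hM hγ hJ hs ht,
    M, hM, fun s u t h1 h2 h3 h4 => hJ s t h1 (h2.trans h3) h4⟩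

/-- A germ of order `γ > 1` has integral zero. -/
theorem HasOrder.isRiemannLim_zero {Ξ : ℝ → ℝ → E} (hγ : 1 < γ)
    (h : HasOrder T γ fun s _ t => Ξ s t) {s t : ℝ} (hs : 0 ≤ s) (ht : t ≤ T) :
    IsRiemannLim Ξ s t 0 := by
  obtain ⟨C, hC, H⟩ := h
  have := isRiemannLim_of_close (Ξ := Ξ) (J := fun _ => 0) (T := T) hC hγ
    (fun s t h1 h2 h3 => by
      simpa using H s s t h1 le_rfl h2 h3) hs ht
  simpa using this

end Orders

/-! ### Controlled paths and their integrals -/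

section Controlled

set_option maxSynthPendingDepth 3

set_option linter.unusedSectionVars false

variable {E F K K₁ K₂ : Type*} [NormedAddCommGroup E] [NormedSpace ℝ E]
  [NormedAddCommGroup F] [NormedSpace ℝ F]
  [NormedAddCommGroup K] [NormedSpace ℝ K] [CompleteSpace K]
  [NormedAddCommGroup K₁] [NormedSpace ℝ K₁] [NormedAddCommGroup K₂] [NormedSpace ℝ K₂]
  {α T : ℝ} {X : ℝ → E} {XX : ℝ → ℝ → ProjTensor E E}

theorem norm_bil_le (A : E →L[ℝ] K₁ →L[ℝ] K) (B : F →L[ℝ] K₁) : ‖bil A B‖ ≤ ‖A‖ * ‖B‖ :=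
  ContinuousLinearMap.opNorm_le_bound₂ _ (by positivity) fun x y => by
    rw [bil_apply]
    calc ‖A x (B y)‖ ≤ ‖A‖ * ‖x‖ * ‖B y‖ := A.le_opNorm₂ _ _
      _ ≤ ‖A‖ * ‖x‖ * (‖B‖ * ‖y‖) := by gcongr; exact B.le_opNorm _
      _ = _ := by ring

theorem IsHolder.bil {A : ℝ → E →L[ℝ] K₁ →L[ℝ] K} {B : ℝ → F →L[ℝ] K₁} (hα : 0 ≤ α)
    (hA : IsHolder α T A) (hB : IsHolder α T B) : IsHolder α T fun t => bil (A t) (B t) := by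
  refine isHolder_of_hasOrder ?_
  have h1 := hA.hasOrder.mul_of_norm_le (hB.hasOrder_zero_right hα) hα le_rfl 1
    (h := fun s _ t => RoughIto.bil (A t - A s) (B t))
    fun s u t => by rw [one_mul]; exact norm_bil_le _ _
  have h2 := (hA.hasOrder_zero hα).mul_of_norm_le hB.hasOrder le_rfl hα 1
    (h := fun s _ t => RoughIto.bil (A s) (B t - B s))
    fun s u t => by rw [one_mul]; exact norm_bil_le _ _
  rw [add_zero] at h1
  rw [zero_add] at h2
  refine (h1.add h2).congr fun s u t _ _ _ _ => ?_
  ext x y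
  simp [bil_apply]

theorem IsHolder.comp {A : ℝ → K₁ →L[ℝ] K₂} {B : ℝ → F →L[ℝ] K₁} (hα : 0 ≤ α)
    (hA : IsHolder α T A) (hB : IsHolder α T B) : IsHolder α T fun t => (A t).comp (B t) :=
  (hA.clm_comp (ContinuousLinearMap.compL ℝ F K₁ K₂)).clm_apply hα hB

theorem IsRoughPath.chen_eq (hX : IsRoughPath α T X XX) {s u t : ℝ} (hs : 0 ≤ s) (hsu : s ≤ u)
    (hut : u ≤ t) (ht : t ≤ T) :
    XX s t = XX s u + XX u t + ptmul (X u - X s) (X t - X u) := by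
  rw [← hX.chen s ⟨hs, by linarith⟩ u ⟨by linarith, by linarith⟩ t ⟨by linarith, ht⟩]
  abel

theorem IsRoughPath.hasOrder_two (hX : IsRoughPath α T X XX) :
    HasOrder T (2 * α) fun s _ t => XX s t :=
  hX.holderTwo.hasOrder fun t ht => by
    -- Chen's relation with three equal times forces the second level to vanish on the diagonal.
    have := hX.chen t ht t ht t ht
    rw [sub_self, ← ptmulL_apply, sub_self, map_zero, zero_sub, neg_eq_zero] at this
    exact this

theorem IsControlled.hasOrder_remainder {P : ℝ → K₁} {P' : ℝ → E →L[ℝ] K₁}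
    (hP : IsControlled α T X P P') :
    HasOrder T (2 * α) fun s _ t => P t - P s - P' s (X t - X s) :=
  IsHolderTwo.hasOrder (f := fun s t => P t - P s - P' s (X t - X s)) hP.holder_remainder
    fun t _ => by simp

/-- A path is controlled if its derivative is Hölder and its remainder is of order `2α` for
`s ≤ t`. -/
theorem isControlled_of_hasOrder {P : ℝ → K₁} {P' : ℝ → E →L[ℝ] K₁} (hT : 0 ≤ T) (hα : 0 ≤ α)
    (hX : IsHolder α T X) (hP' : IsHolder α T P')
    (hR : HasOrder T (2 * α) fun s _ t => P t - P s - P' s (X t - X s)) :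
    IsControlled α T X P P' := by
  refine ⟨isHolder_of_hasOrder ?_, hP', isHolderTwo_of_hasOrder hR ?_⟩
  · have h1 := HasOrder.mono hT hα (by linarith) hR
    have h2 := ((hP'.hasOrder_zero hα).clm_apply hX.hasOrder le_rfl hα).of_eq (zero_add α)
    exact (h1.add h2).congr fun s u t _ _ _ _ => by abel
  -- The reversed remainder is R_{t,s} = P'_{s,t} X_{s,t} - R_{s,t}.
  · have h2 := (hP'.hasOrder.clm_apply hX.hasOrder hα hα).of_eq (two_mul α).symm
    refine (h2.sub hR).congr fun s u t _ _ _ _ => ?_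
    simp only [map_sub, sub_apply]
    abel

/-- The remainder is zero. This case makes integrals against the driving path itself, and
evaluations such as δ_{Y_t}(W_t), instances of the general theory. -/
theorem isControlled_self (hα : 0 ≤ α) (hT : 0 ≤ T) (hX : IsHolder α T X) :
    IsControlled α T X X fun _ => ContinuousLinearMap.id ℝ E :=
  isControlled_of_hasOrder hT hα hX
    (isHolder_of_hasOrder ⟨0, le_rfl, fun s u t _ _ _ _ => by simp⟩)
    ⟨0, le_rfl, fun s u t _ _ _ _ => by simp⟩

theorem IsControlled.clm_comp {P : ℝ → K₁} {P' : ℝ → E →L[ℝ] K₁} (hP : IsControlled α T X P P')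
    (L : K₁ →L[ℝ] K₂) : IsControlled α T X (fun t => L (P t)) (fun t => L.comp (P' t)) := by
  refine ⟨hP.holder.clm_comp L,
    hP.holder_deriv.clm_comp (ContinuousLinearMap.compL ℝ E K₁ K₂ L), ?_⟩
  obtain ⟨C, H⟩ := hP.holder_remainder
  refine ⟨‖L‖ * C, fun s hs t ht hst => ?_⟩
  have : L (P t) - L (P s) - (L.comp (P' s)) (X t - X s)
      = L (P t - P s - P' s (X t - X s)) := by simp
  simp only [this, mul_assoc]
  exact (L.le_opNorm _).trans (mul_le_mul_of_nonneg_left (H s hs t ht hst) (norm_nonneg _))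

variable (K K₁) in
/-- The evaluation `y ↦ (A ↦ A y)`. -/
def evalOp : K₁ →L[ℝ] (K₁ →L[ℝ] K) →L[ℝ] K := (ContinuousLinearMap.id ℝ (K₁ →L[ℝ] K)).flip

theorem evalOp_apply (y : K₁) (A : K₁ →L[ℝ] K) : evalOp K K₁ y A = A y := rfl

variable {Q : ℝ → K₁ →L[ℝ] K} {Q' : ℝ → E →L[ℝ] K₁ →L[ℝ] K} {P : ℝ → K₁} {P' : ℝ → E →L[ℝ] K₁}

/-- The product rule for controlled paths. -/
theorem IsControlled.clm_apply (hT : 0 ≤ T) (hα : 0 ≤ α) (hX : IsHolder α T X)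
    (hQ : IsControlled α T X Q Q') (hP : IsControlled α T X P P') :
    IsControlled α T X (fun t => Q t (P t)) (fun t => (Q t).comp (P' t) + (evalOp K K₁ (P t)).comp (Q' t)) := by
  refine isControlled_of_hasOrder hT hα hX ?_ ?_
  · have h1 : IsHolder α T fun t => (Q t).comp (P' t) := IsHolder.comp hα hQ.holder hP.holder_deriv
    have h2 := IsHolder.clm_comp (F := (K₁ →L[ℝ] K) →L[ℝ] K) hP.holder (evalOp K K₁)
    have h3 : IsHolder α T fun t => (evalOp K K₁ (P t)).comp (Q' t) :=
      IsHolder.comp hα h2 hQ.holder_deriv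
    exact h1.add h3
  -- The remainder of the product is Q_s R^P_{s,t} + R^Q_{s,t} P_s + Q_{s,t} P_{s,t}.
  · have h1 := ((hQ.holder.hasOrder_zero hα).clm_apply hP.hasOrder_remainder le_rfl
      (by linarith)).of_eq (zero_add _)
    have h2 := (hQ.hasOrder_remainder.clm_apply (hP.holder.hasOrder_zero hα) (by linarith)
      le_rfl).of_eq (add_zero _)
    have h3 := (hQ.holder.hasOrder.clm_apply hP.holder.hasOrder hα hα).of_eq (two_mul α).symm
    refine ((h1.add h2).add h3).congr fun s u t _ _ _ _ => ?_
    simp only [map_sub, sub_apply, add_apply, ContinuousLinearMap.comp_apply,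
      evalOp_apply]
    abel

/-- By Chen the defect is -Q_{s,u} P_{u,t} + (Q'_s P'_s)(X_{s,u} ⊗ X_{u,t}) - (Q'P')_{s,u} 𝕏_{u,t}.
Expanding Q_{s,u} and P_{u,t} by their remainders cancels the middle term, and the four products
that remain have order 3α. -/
theorem hasOrder_germLeft (hα : 0 ≤ α) (hX : IsRoughPath α T X XX)
    (hQ : IsControlled α T X Q Q') (hP : IsControlled α T X P P') :
    HasOrder T (3 * α) fun s u t => germLeft XX Q Q' P P' s t - germLeft XX Q Q' P P' s u
      - germLeft XX Q Q' P P' u t := by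
  have h2α : 0 ≤ 2 * α := by linarith
  have hQX := ((hQ.holder_deriv.hasOrder_zero hα).clm_apply
    (HasOrder.left hα hX.holder.hasOrder) le_rfl hα).of_eq (zero_add α)
  have h1 := ((HasOrder.left h2α hQ.hasOrder_remainder).clm_apply
    (HasOrder.right hα hP.holder.hasOrder) h2α hα).of_eq (show _ = 3 * α by ring)
  have h2 := (hQX.clm_apply (HasOrder.right h2α hP.hasOrder_remainder) hα h2α).of_eq
    (show _ = 3 * α by ring)
  have h3 := (hQX.clm_apply ((HasOrder.left hα hP.holder_deriv.hasOrder).clm_apply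
    (HasOrder.right hα hX.holder.hasOrder) hα hα) hα (by linarith)).of_eq
    (show _ = 3 * α by ring)
  have h4 := ((HasOrder.left hα (IsHolder.bil hα hQ.holder_deriv hP.holder_deriv).hasOrder
    ).plift_apply (HasOrder.right h2α hX.hasOrder_two) hα h2α).of_eq (show _ = 3 * α by ring)
  refine (((h1.add h2).add h3).add h4).neg.congr fun s u t hs hsu hut ht => ?_
  simp only [germLeft]
  rw [hX.chen_eq hs hsu hut ht, map_add, map_add, plift_ptmul, bil_apply, plift_sub]
  simp only [map_sub, sub_apply]
  abel

theorem exists_integralPath_germLeft (hα : 1 / 3 < α) (hX : IsRoughPath α T X XX)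
    (hQ : IsControlled α T X Q Q') (hP : IsControlled α T X P P') :
    ∃ J, IsIntegralPath T (germLeft XX Q Q' P P') J ∧
      HasOrder T (3 * α) fun s _ t => J t - J s - germLeft XX Q Q' P P' s t :=
  (hasOrder_germLeft (by linarith) hX hQ hP).exists_integralPath (by linarith)

/-- The integral of controlled paths is controlled. -/
theorem isControlled_integral (hT : 0 ≤ T) (hα : 0 ≤ α) (hX : IsRoughPath α T X XX)
    (hQ : IsControlled α T X Q Q') (hP : IsControlled α T X P P') {J : ℝ → K}
    (hJ : HasOrder T (3 * α) fun s _ t => J t - J s - germLeft XX Q Q' P P' s t) :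
    IsControlled α T X J fun t => (Q t).comp (P' t) := by
  have h2α : 0 ≤ 2 * α := by linarith
  refine isControlled_of_hasOrder hT hα hX.holder (IsHolder.comp hα hQ.holder hP.holder_deriv) ?_
  have h1 := HasOrder.mono hT h2α (by linarith) hJ
  have h2 := ((hQ.holder.hasOrder_zero hα).clm_apply hP.hasOrder_remainder le_rfl h2α).of_eq
    (zero_add _)
  have h3 := (((IsHolder.bil hα hQ.holder_deriv hP.holder_deriv).hasOrder_zero hα).plift_apply
    hX.hasOrder_two le_rfl h2α).of_eq (zero_add _)
  refine ((h1.add h2).add h3).congr fun s u t _ _ _ _ => ?_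
  simp only [germLeft, map_sub, ContinuousLinearMap.comp_apply]
  abel

/-! ### Compensators -/

/-- Changing the base point a only subtracts the increment of Q_a P, which is additive. One integral
path of the base-free germ therefore serves for every a. -/
theorem compLeftGerm_eq (a u v : ℝ) : compLeftGerm XX Q Q' P P' a u v
    = germLeft XX Q Q' P P' u v - (Q a (P v) - Q a (P u)) := by
  simp only [compLeftGerm, germLeft, sub_apply, map_sub]
  abel

theorem IsIntegralPath.compLeftGerm {J : ℝ → K}
    (hJ : IsIntegralPath T (germLeft XX Q Q' P P') J) (a : ℝ) :
    IsIntegralPath T (compLeftGerm XX Q Q' P P' a) (fun t => J t - Q a (P t)) := by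
  intro s t hs hst ht
  have := (hJ s t hs hst ht).sub (isIntegralPath_sub T (fun t => Q a (P t)) s t hs hst ht)
  rw [funext₂ (compLeftGerm_eq a)]
  convert this using 1
  dsimp only
  abel

/-- A closed form valid for both orders of s and t, thanks to the sign convention in `germInt`. The
algebraic properties of the compensators are read off from it. -/
theorem IsIntegralPath.compLeft_eq {J : ℝ → K}
    (hJ : IsIntegralPath T (germLeft XX Q Q' P P') J) {s t : ℝ} (hs : s ∈ Set.Icc 0 T)
    (ht : t ∈ Set.Icc 0 T) : compLeft XX Q Q' P P' s t
      = (Q t - Q s) (P t - P s) - (2 : ℝ) • (J t - J s - Q s (P t - P s)) := by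
  rw [compLeft, (hJ.compLeftGerm s).germInt_eq hs ht]
  simp only [map_sub]
  congr 2
  abel

/-- The integral differs from its germ by order 3α, and the germ based at s has no first-level term
at s; only the second level, with factor -2, corrects the product of increments. -/
theorem hasOrder_compLeft_sub (hα : 1 / 3 < α) (hX : IsRoughPath α T X XX)
    (hQ : IsControlled α T X Q Q') (hP : IsControlled α T X P P') :
    HasOrder T (3 * α) fun s _ t => compLeft XX Q Q' P P' s t
      - ((Q t - Q s) (P t - P s) - (2 : ℝ) • plift (bil (Q' s) (P' s)) (XX s t)) := by
  obtain ⟨J, hJ, hJ'⟩ := exists_integralPath_germLeft hα hX hQ hP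
  refine (hJ'.const_smul (-2)).congr fun s u t hs hsu hut ht => ?_
  rw [hJ.compLeft_eq ⟨hs, by linarith⟩ ⟨by linarith, ht⟩, germLeft]
  module

theorem isHolderTwo_compLeft (hT : 0 ≤ T) (hα : 1 / 3 < α) (hX : IsRoughPath α T X XX)
    (hQ : IsControlled α T X Q Q') (hP : IsControlled α T X P P') :
    IsHolderTwo (2 * α) T (compLeft XX Q Q' P P') := by
  have hα0 : 0 ≤ α := by linarith
  have h2α : 0 ≤ 2 * α := by linarith
  obtain ⟨J, hJ, -⟩ := exists_integralPath_germLeft hα hX hQ hP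
  have h1 := HasOrder.mono hT h2α (by linarith) (hasOrder_compLeft_sub hα hX hQ hP)
  have h2 := (hQ.holder.hasOrder.clm_apply hP.holder.hasOrder hα0 hα0).of_eq (two_mul α).symm
  have h3 := ((((IsHolder.bil hα0 hQ.holder_deriv hP.holder_deriv).hasOrder_zero hα0).plift_apply
    hX.hasOrder_two le_rfl h2α).of_eq (zero_add _)).const_smul 2
  have h4 : HasOrder T (2 * α) fun s _ t => compLeft XX Q Q' P P' s t :=
    ((h1.add h2).sub h3).congr fun s u t _ _ _ _ => by abel
  -- The compensator is antisymmetric under exchange of its two times, so the bound for s ≤ t gives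
  -- the other half.
  refine isHolderTwo_of_hasOrder h4 (h4.neg.congr fun s u t hs hsu hut ht => ?_)
  have hs' : s ∈ Set.Icc 0 T := ⟨hs, by linarith⟩
  have ht' : t ∈ Set.Icc 0 T := ⟨by linarith, ht⟩
  rw [hJ.compLeft_eq hs' ht', hJ.compLeft_eq ht' hs']
  simp only [map_sub, sub_apply]
  module

/-- The integral path is additive, so the defect comes from the products of increments alone. It
changes sign when the roles of the intervals [s, u] and [u, t] are exchanged, which drives both
cancellations behind the Young integrals. -/
theorem compLeft_sub_sub (hα : 1 / 3 < α) (hX : IsRoughPath α T X XX)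
    (hQ : IsControlled α T X Q Q') (hP : IsControlled α T X P P') {s u t : ℝ} (hs : 0 ≤ s)
    (hsu : s ≤ u) (hut : u ≤ t) (ht : t ≤ T) :
    compLeft XX Q Q' P P' s t - compLeft XX Q Q' P P' s u - compLeft XX Q Q' P P' u t
      = (Q t - Q u) (P u - P s) - (Q u - Q s) (P t - P u) := by
  obtain ⟨J, hJ, -⟩ := exists_integralPath_germLeft hα hX hQ hP
  have hs' : s ∈ Set.Icc 0 T := ⟨hs, by linarith⟩
  have hu' : u ∈ Set.Icc 0 T := ⟨by linarith, by linarith⟩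
  have ht' : t ∈ Set.Icc 0 T := ⟨by linarith, ht⟩
  rw [hJ.compLeft_eq hs' ht', hJ.compLeft_eq hs' hu', hJ.compLeft_eq hu' ht']
  simp only [map_sub, sub_apply]
  module

/-- The Young integral against a two-parameter function exists if the increments of the latter are
in the kernel of the integrand. -/
theorem exists_integralPath_youngGerm {A : ℝ → K₁ →L[ℝ] K} {Ψ : ℝ → ℝ → K₁} (hα : 1 / 3 < α)
    (hA : IsHolder α T A) (hΨ : HasOrder T (2 * α) fun s _ t => Ψ s t)
    (h : ∀ s u t, 0 ≤ s → s ≤ u → u ≤ t → t ≤ T → A s (Ψ s t - Ψ s u - Ψ u t) = 0) :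
    ∃ J, IsIntegralPath T (youngGerm A Ψ) J := by
  have h2α : 0 ≤ 2 * α := by linarith
  have hα0 : 0 ≤ α := by linarith
  -- Once A_s kills the defect of Ψ, the defect of the germ is -A_{s,u} Ψ_{u,t}, of order α + 2α.
  have h1 := ((HasOrder.left hα0 hA.hasOrder).clm_apply (HasOrder.right h2α hΨ) hα0 h2α).of_eq
    (show _ = 3 * α by ring)
  have h2 : HasOrder T (3 * α) fun s u t =>
      youngGerm A Ψ s t - youngGerm A Ψ s u - youngGerm A Ψ u t := by
    refine h1.neg.congr fun s u t hs hsu hut ht => ?_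
    have := h s u t hs hsu hut ht
    rw [sub_sub, map_sub, sub_eq_zero] at this
    simp only [youngGerm, sub_apply, this, map_add]
    abel
  obtain ⟨J, hJ, -⟩ := h2.exists_integralPath (by linarith)
  exact ⟨J, hJ⟩


theorem hasOrder_compLeft (hT : 0 ≤ T) (hα : 1 / 3 < α) (hX : IsRoughPath α T X XX)
    (hQ : IsControlled α T X Q Q') (hP : IsControlled α T X P P') :
    HasOrder T (2 * α) fun s _ t => compLeft XX Q Q' P P' s t := by
  refine (isHolderTwo_compLeft hT hα hX hQ hP).hasOrder fun t ht => ?_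
  obtain ⟨J, hJ, -⟩ := exists_integralPath_germLeft hα hX hQ hP
  rw [hJ.compLeft_eq ht ht]
  simp

/-! ### The tensor and right-hand integrals as instances of the left-hand one -/

theorem germTensor_eq_germLeft (Z : ℝ → K₂) (Z' : ℝ → E →L[ℝ] K₂) :
    germTensor XX Z Z' P P' = germLeft XX (fun t => ptmulL K₂ K₁ (Z t))
      (fun t => (ptmulL K₂ K₁).comp (Z' t)) P P' := rfl

theorem compTensorGerm_eq_compLeftGerm (s : ℝ) :
    compTensorGerm XX P P' s = compLeftGerm XX (fun t => ptmulL K₁ K₁ (P t))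
      (fun t => (ptmulL K₁ K₁).comp (P' t)) P P' s := by
  rw [compTensorGerm, compLeftGerm, germTensor_eq_germLeft]
  simp only [map_sub]

theorem compTensor_eq_compLeft :
    compTensor XX P P' = compLeft XX (fun t => ptmulL K₁ K₁ (P t))
      (fun t => (ptmulL K₁ K₁).comp (P' t)) P P' := by
  funext s t
  rw [compTensor, compLeft, compTensorGerm_eq_compLeftGerm, ← map_sub, ptmulL_apply]

/-- Regard P_t as the operator A ↦ A P_t, to be integrated against Q. The transpose on the second
level restores the order of the two factors. -/
theorem germRight_eq_germLeft :
    germRight XX Q Q' P P' = germLeft XX (fun t => evalOp K K₁ (P t))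
      (fun t => (evalOp K K₁).comp (P' t)) Q Q' := by
  funext u v
  rw [germRight, germLeft, plift_pswap]
  rfl

theorem compRightGerm_eq_compLeftGerm (s : ℝ) :
    compRightGerm XX Q Q' P P' s = compLeftGerm XX (fun t => evalOp K K₁ (P t))
      (fun t => (evalOp K K₁).comp (P' t)) Q Q' s := by
  rw [compRightGerm, compLeftGerm, germRight_eq_germLeft]
  simp only [map_sub]

theorem compRight_eq_compLeft :
    compRight XX Q Q' P P' = compLeft XX (fun t => evalOp K K₁ (P t))
      (fun t => (evalOp K K₁).comp (P' t)) Q Q' := by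
  funext s t
  rw [compRight, compLeft, compRightGerm_eq_compLeftGerm, ← map_sub, evalOp_apply]

end Controlled

/-! ### Taylor estimates -/

section Taylor

set_option maxSynthPendingDepth 3

variable {V G : Type*} [NormedAddCommGroup V] [NormedSpace ℝ V] [NormedAddCommGroup G]
  [NormedSpace ℝ G] {f : V → G} {S : Set V} {M : ℝ} {x y : V}

theorem norm_sub_sub_fderiv_le (hS : Convex ℝ S) (hf : Differentiable ℝ f)
    (hf' : Differentiable ℝ (fderiv ℝ f)) (hM : ∀ z ∈ S, ‖fderiv ℝ (fderiv ℝ f) z‖ ≤ M)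
    (hx : x ∈ S) (hy : y ∈ S) : ‖f y - f x - fderiv ℝ f x (y - x)‖ ≤ M * (‖y - x‖ * ‖y - x‖) := by
  have hM0 : 0 ≤ M := (norm_nonneg _).trans (hM x hx)
  rw [← mul_assoc]
  refine (convex_segment x y).norm_image_sub_le_of_norm_hasFDerivWithin_le' (f := f)
    (f' := fderiv ℝ f) (fun z _ => (hf z).hasFDerivAt.hasFDerivWithinAt) (fun z hz => ?_)
    (left_mem_segment ℝ x y) (right_mem_segment ℝ x y)
  refine (hS.norm_image_sub_le_of_norm_fderiv_le (fun w _ => hf' w) hM hx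
    (hS.segment_subset hx hy hz)).trans ?_
  exact mul_le_mul_of_nonneg_left (norm_sub_le_of_mem_segment hz) hM0

/-- Subtract the quadratic term from f. By symmetry of D²f(x) the derivative of the difference is
Df(z) - D²f(x)(z - x), which the first-order estimate for Df compares with Df(x); the mean value
inequality on the segment finishes. The constant is not optimal. -/
theorem norm_sub_sub_fderiv_sub_le (hS : Convex ℝ S) (hf : ContDiff ℝ 3 f)
    (hM : ∀ z ∈ S, ‖fderiv ℝ (fderiv ℝ (fderiv ℝ f)) z‖ ≤ M) (hx : x ∈ S) (hy : y ∈ S) :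
    ‖f y - f x - fderiv ℝ f x (y - x)
        - (1 / 2 : ℝ) • fderiv ℝ (fderiv ℝ f) x (y - x) (y - x)‖
      ≤ M * (‖y - x‖ * (‖y - x‖ * ‖y - x‖)) := by
  have hM0 : 0 ≤ M := (norm_nonneg _).trans (hM x hx)
  have d1 : Differentiable ℝ f := hf.differentiable (by simp)
  have c2 : ContDiff ℝ 2 (fderiv ℝ f) := hf.fderiv_right (by norm_num)
  have d2 : Differentiable ℝ (fderiv ℝ f) := c2.differentiable (by simp)
  have c3 : ContDiff ℝ 1 (fderiv ℝ (fderiv ℝ f)) := c2.fderiv_right (by norm_num)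
  have d3 : Differentiable ℝ (fderiv ℝ (fderiv ℝ f)) := c3.differentiable (by simp)
  have hsymm : IsSymmSndFDerivAt ℝ f x := hf.contDiffAt.isSymmSndFDerivAt (by
    rw [minSmoothness_of_isRCLikeNormedField]; norm_num)
  set B := fderiv ℝ (fderiv ℝ f) x with hB
  set g : V → G := fun z => f z - (1 / 2 : ℝ) • B (z - x) (z - x) with hg
  have hgd : ∀ z, HasFDerivAt g (fderiv ℝ f z - B (z - x)) z := by
    intro z
    have h1 : HasFDerivAt (fun z => z - x) (ContinuousLinearMap.id ℝ V) z :=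
      (hasFDerivAt_id z).sub_const x
    have h2 : HasFDerivAt (fun z => B (z - x)) (B.comp (ContinuousLinearMap.id ℝ V)) z :=
      B.hasFDerivAt.comp z h1
    have h3 := (d1 z).hasFDerivAt.sub ((h2.clm_apply h1).const_smul (1 / 2 : ℝ))
    have e : fderiv ℝ f z - B (z - x) = fderiv ℝ f z - (1 / 2 : ℝ) •
        ((B (z - x)).comp (ContinuousLinearMap.id ℝ V)
          + (B.comp (ContinuousLinearMap.id ℝ V)).flip (z - x)) := by
      ext w
      have hw : B w (z - x) = B (z - x) w := hsymm w (z - x)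
      simp only [sub_apply, add_apply, smul_apply,
        ContinuousLinearMap.comp_apply, ContinuousLinearMap.flip_apply, ContinuousLinearMap.id_apply,
        hw]
      module
    rw [e]
    exact h3
  have h := (convex_segment x y).norm_image_sub_le_of_norm_hasFDerivWithin_le' (f := g)
    (C := M * (‖y - x‖ * ‖y - x‖)) (φ := fderiv ℝ f x)
    (fun z _ => (hgd z).hasFDerivWithinAt) (fun z hz => ?_)
    (left_mem_segment ℝ x y) (right_mem_segment ℝ x y)
  · have e : g y - g x - fderiv ℝ f x (y - x) = f y - f x - fderiv ℝ f x (y - x)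
        - (1 / 2 : ℝ) • B (y - x) (y - x) := by
      simp only [hg, sub_self, map_zero, smul_zero, sub_zero]
      abel
    rw [e] at h
    linarith
  · have e : fderiv ℝ f z - B (z - x) - fderiv ℝ f x
        = fderiv ℝ f z - fderiv ℝ f x - B (z - x) := by abel
    rw [e]
    refine (norm_sub_sub_fderiv_le hS d2 d3 hM hx (hS.segment_subset hx hy hz)).trans ?_
    have := norm_sub_le_of_mem_segment hz
    gcongr

end Taylor

/-! ### Derivative bounds on balls, uniform in the field φ. -/

section GrowthBounds

set_option maxSynthPendingDepth 3

variable {V : Type*} [NormedAddCommGroup V] [NormedSpace ℝ V] {β : Fin (3 + 1) → ℝ}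

theorem GrowthSpace.exists_norm_iteratedFDeriv_le (hβ : ∀ k, 0 ≤ β k) (R : ℝ) :
    ∃ M, 0 ≤ M ∧ ∀ (φ : GrowthSpace V β) (k : Fin (3 + 1)) (y : V), ‖y‖ ≤ R →
      ‖iteratedFDeriv ℝ k φ y‖ ≤ M * ‖φ‖ := by
  -- The sum serves all orders k with one constant; βₖ ≥ 0 makes the weights increasing in ‖y‖.
  refine ⟨∑ k, (1 + |R|) ^ β k, by positivity, fun φ k y hy => ?_⟩
  refine (φ.norm_iteratedFDeriv_le k y).trans (mul_le_mul_of_nonneg_right ?_ (norm_nonneg _))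
  have h1 : (1 + ‖y‖) ^ β k ≤ (1 + |R|) ^ β k :=
    Real.rpow_le_rpow (by positivity) (by linarith [le_abs_self R]) (hβ k)
  exact h1.trans (Finset.single_le_sum (f := fun k => (1 + |R|) ^ β k)
    (fun i _ => by positivity) (Finset.mem_univ k))

theorem GrowthSpace.exists_norm_fderiv_le (hβ : ∀ k, 0 ≤ β k) (R : ℝ) :
    ∃ M, 0 ≤ M ∧ ∀ (φ : GrowthSpace V β), ∀ y ∈ Metric.closedBall (0 : V) R,
      ‖fderiv ℝ φ y‖ ≤ M * ‖φ‖ ∧ ‖fderiv ℝ (fderiv ℝ φ) y‖ ≤ M * ‖φ‖ ∧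
      ‖fderiv ℝ (fderiv ℝ (fderiv ℝ φ)) y‖ ≤ M * ‖φ‖ := by
  obtain ⟨M, hM, H⟩ := GrowthSpace.exists_norm_iteratedFDeriv_le (V := V) hβ R
  refine ⟨M, hM, fun φ y hy => ?_⟩
  rw [mem_closedBall_zero_iff] at hy
  have h1 := H φ 1 y hy
  have h2 := H φ 2 y hy
  have h3 := H φ 3 y hy
  change ‖iteratedFDeriv ℝ 1 φ y‖ ≤ _ at h1
  change ‖iteratedFDeriv ℝ (1 + 1) φ y‖ ≤ _ at h2
  change ‖iteratedFDeriv ℝ (1 + 1 + 1) φ y‖ ≤ _ at h3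
  rw [norm_iteratedFDeriv_one] at h1
  rw [← norm_iteratedFDeriv_fderiv, norm_iteratedFDeriv_one] at h2
  rw [← norm_iteratedFDeriv_fderiv, ← norm_iteratedFDeriv_fderiv, norm_iteratedFDeriv_one] at h3
  exact ⟨h1, h2, h3⟩

/-- The Taylor bounds on a ball are linear in ‖φ‖, hence they are operator-norm bounds for the
evaluations as functions of the point. Three derivatives give `ev` and `evD` quadratic first-order
remainders and make `evD2` Lipschitz. -/
theorem exists_norm_ev_le (hβ : ∀ k, 0 ≤ β k) (R : ℝ) :
    ∃ M, 0 ≤ M ∧ ∀ x ∈ Metric.closedBall (0 : V) R, ∀ y ∈ Metric.closedBall (0 : V) R,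
      ‖evD β y - evD β x‖ ≤ M * ‖y - x‖ ∧
      ‖evD2 β y - evD2 β x‖ ≤ M * ‖y - x‖ ∧
      ‖ev β y - ev β x - (evD β x).flip (y - x)‖ ≤ M * (‖y - x‖ * ‖y - x‖) ∧
      ‖evD β y - evD β x - (evD2 β x).flip (y - x)‖ ≤ M * (‖y - x‖ * ‖y - x‖) ∧
      ∀ φ : GrowthSpace V β, ‖φ y - φ x - fderiv ℝ φ x (y - x)
        - (1 / 2 : ℝ) • fderiv ℝ (fderiv ℝ φ) x (y - x) (y - x)‖
        ≤ M * ‖φ‖ * (‖y - x‖ * (‖y - x‖ * ‖y - x‖)) := by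
  obtain ⟨M, hM, H⟩ := GrowthSpace.exists_norm_fderiv_le (V := V) hβ R
  have hS := convex_closedBall (0 : V) R
  have d1 : ∀ φ : GrowthSpace V β, Differentiable ℝ φ := GrowthSpace.differentiable (by norm_num)
  have d2 : ∀ φ : GrowthSpace V β, Differentiable ℝ (fderiv ℝ φ) :=
    GrowthSpace.differentiable_fderiv (by norm_num)
  have d3 : ∀ φ : GrowthSpace V β, Differentiable ℝ (fderiv ℝ (fderiv ℝ φ)) := fun φ =>
    ((φ.contDiff.fderiv_right (m := 2) (by norm_cast)).fderiv_right (m := 1)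
      (by norm_num)).differentiable (by simp)
  refine ⟨M, hM, fun x hx y hy => ⟨?_, ?_, ?_, ?_, fun φ => ?_⟩⟩
  · refine ContinuousLinearMap.opNorm_le_bound _ (by positivity) fun φ => ?_
    refine (hS.norm_image_sub_le_of_norm_fderiv_le (f := fderiv ℝ φ) (fun w _ => d2 φ w)
      (fun z hz => (H φ z hz).2.1) hx hy).trans (le_of_eq (by ring))
  · refine ContinuousLinearMap.opNorm_le_bound _ (by positivity) fun φ => ?_
    refine (hS.norm_image_sub_le_of_norm_fderiv_le (f := fderiv ℝ (fderiv ℝ φ))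
      (fun w _ => d3 φ w) (fun z hz => (H φ z hz).2.2) hx hy).trans (le_of_eq (by ring))
  · refine ContinuousLinearMap.opNorm_le_bound _ (by positivity) fun φ => ?_
    exact (norm_sub_sub_fderiv_le hS (d1 φ) (d2 φ) (fun z hz => (H φ z hz).2.1) hx hy).trans
      (le_of_eq (by ring))
  · refine ContinuousLinearMap.opNorm_le_bound _ (by positivity) fun φ => ?_
    exact (norm_sub_sub_fderiv_le hS (d2 φ) (d3 φ) (fun z hz => (H φ z hz).2.2) hx hy).trans
      (le_of_eq (by ring))
  · exact norm_sub_sub_fderiv_sub_le hS φ.contDiff (fun z hz => (H φ z hz).2.2) hx hy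

end GrowthBounds

/-! ### Evaluation along a controlled path -/

section Evaluation

set_option maxSynthPendingDepth 3

variable {E V G : Type*} [NormedAddCommGroup E] [NormedSpace ℝ E] [NormedAddCommGroup V]
  [NormedSpace ℝ V] [NormedAddCommGroup G] [NormedSpace ℝ G] {α T : ℝ} {X : ℝ → E}
  {Y : ℝ → V} {Y' : ℝ → E →L[ℝ] V}

theorem IsHolder.comp_of_norm_le {L : V → G} {M : ℝ} {S : Set V} (hY : IsHolder α T Y)
    (hYS : ∀ t ∈ Set.Icc 0 T, Y t ∈ S) (hL : ∀ x ∈ S, ∀ y ∈ S, ‖L y - L x‖ ≤ M * ‖y - x‖) :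
    IsHolder α T fun t => L (Y t) :=
  isHolder_of_hasOrder (hY.hasOrder.of_norm_le M fun s u t hs hsu hut ht =>
    hL _ (hYS s ⟨hs, by linarith⟩) _ (hYS t ⟨by linarith, ht⟩))

/-- A smooth function of a controlled path is controlled. -/
theorem IsControlled.comp_of_taylor {L : V → E →L[ℝ] G} {L' : V → E →L[ℝ] V →L[ℝ] G} {M : ℝ}
    {S : Set V} (hT : 0 ≤ T) (hα : 0 ≤ α) (hX : IsHolder α T X) (hY : IsControlled α T X Y Y')
    (hYS : ∀ t ∈ Set.Icc 0 T, Y t ∈ S) (hL' : ∀ x ∈ S, ∀ y ∈ S, ‖L' y - L' x‖ ≤ M * ‖y - x‖)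
    (hL : ∀ x ∈ S, ∀ y ∈ S, ‖L y - L x - (L' x).flip (y - x)‖ ≤ M * (‖y - x‖ * ‖y - x‖)) :
    IsControlled α T X (fun t => L (Y t)) (fun t => (L' (Y t)).flip.comp (Y' t)) := by
  have hflip : IsHolder α T fun t => (L' (Y t)).flip :=
    IsHolder.comp_of_norm_le (L := fun y => (L' y).flip) (M := M) hY.holder hYS
      fun x hx y hy => by
        refine le_trans (le_of_eq ?_) (hL' x hx y hy)
        rw [← ContinuousLinearMap.opNorm_flip (L' y - L' x)]
        rfl
  refine isControlled_of_hasOrder hT hα hX (IsHolder.comp hα hflip hY.holder_deriv) ?_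
  have h1 : HasOrder T (2 * α) fun s _ t => L (Y t) - L (Y s) - (L' (Y s)).flip (Y t - Y s) := by
    have h := (hY.holder.hasOrder.mul_of_norm_le hY.holder.hasOrder hα hα 1
      (h := fun s _ t => ‖Y t - Y s‖ * ‖Y t - Y s‖) (fun s u t => by simp)).of_eq (two_mul α).symm
    refine h.of_norm_le M fun s u t hs hsu hut ht => ?_
    have := hL _ (hYS s ⟨hs, by linarith⟩) _ (hYS t ⟨by linarith, ht⟩)
    rwa [norm_mul, norm_norm]
  have h2 := ((hflip.hasOrder_zero hα).clm_apply hY.hasOrder_remainder le_rfl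
    (by linarith)).of_eq (zero_add _)
  refine (h1.add h2).congr fun s u t _ _ _ _ => ?_
  simp only [map_sub, ContinuousLinearMap.comp_apply]
  abel

end Evaluation

/-! ### The Itô formula -/

section ItoFormula

set_option maxSynthPendingDepth 3
set_option linter.unusedSectionVars false

variable {V K : Type*} [NormedAddCommGroup V] [NormedSpace ℝ V] [CompleteSpace V]
  [NormedAddCommGroup K] [NormedSpace ℝ K] [CompleteSpace K] {β : Fin (3 + 1) → ℝ} {α T : ℝ}
  {W : ℝ → GrowthSpace V β} {WW : ℝ → ℝ → ProjTensor (GrowthSpace V β) (GrowthSpace V β)}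
  {Y : ℝ → V} {Y' : ℝ → GrowthSpace V β →L[ℝ] V} {Z : ℝ → V →L[ℝ] K}
  {Z' : ℝ → GrowthSpace V β →L[ℝ] V →L[ℝ] K}

/-- Passes from the path supplied by sewing to the integral started at 0, the form in which G and X
are defined; the two have the same increments. -/
theorem isIntegralPath_germInt_zero {Ξ : ℝ → ℝ → K} {γ : ℝ} (hT : 0 ≤ T)
    (h : ∃ J, IsIntegralPath T Ξ J ∧ HasOrder T γ fun s _ t => J t - J s - Ξ s t) :
    IsIntegralPath T Ξ (germInt Ξ 0) ∧
      HasOrder T γ fun s _ t => germInt Ξ 0 t - germInt Ξ 0 s - Ξ s t := by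
  obtain ⟨J, hJ, hJ'⟩ := h
  have e : ∀ s t, 0 ≤ s → s ≤ t → t ≤ T → germInt Ξ 0 t - germInt Ξ 0 s = J t - J s := by
    intro s t hs hst ht
    rw [hJ.germInt_eq ⟨le_rfl, hT⟩ ⟨hs.trans hst, ht⟩,
      hJ.germInt_eq ⟨le_rfl, hT⟩ ⟨hs, hst.trans ht⟩]
    abel
  refine ⟨fun s t hs hst ht => ?_, hJ'.congr fun s u t hs hsu hut ht => ?_⟩
  · rw [e s t hs hst ht]
    exact hJ s t hs hst ht
  · rw [e s t hs (hsu.trans hut) ht]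

theorem IsHolder.plift {E F : Type*} [NormedAddCommGroup E] [NormedSpace ℝ E]
    [NormedAddCommGroup F] [NormedSpace ℝ F] {B : ℝ → E →L[ℝ] F →L[ℝ] K} (hB : IsHolder α T B) :
    IsHolder α T fun t => plift (B t) := by
  refine isHolder_of_hasOrder (hB.hasOrder.of_norm_le 1 fun s u t _ _ _ _ => ?_)
  rw [← plift_sub, one_mul]
  exact ContinuousLinearMap.opNorm_le_bound _ (norm_nonneg _) (norm_plift_le _)

/-- The Gubinelli derivative of `t ↦ δ_{Y_t}`. -/
def evDeriv (Y : ℝ → V) (Y' : ℝ → GrowthSpace V β →L[ℝ] V) (t : ℝ) :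
    GrowthSpace V β →L[ℝ] GrowthSpace V β →L[ℝ] V := (evD β (Y t)).flip.comp (Y' t)

/-- The Gubinelli derivative of `t ↦ (φ ↦ Dφ(Y_t))`. -/
def evDDeriv (Y : ℝ → V) (Y' : ℝ → GrowthSpace V β →L[ℝ] V) (t : ℝ) :
    GrowthSpace V β →L[ℝ] GrowthSpace V β →L[ℝ] V →L[ℝ] V := (evD2 β (Y t)).flip.comp (Y' t)

/-- The nonlinear integral is the linear one of δ_{Y_r} against W, since W_{u,v}(Y_u) =
δ_{Y_u}(W_{u,v}). -/
theorem germG_eq_germLeft : germG W WW Y Y' = germLeft WW (fun t => ev β (Y t)) (evDeriv Y Y') W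
    fun _ => ContinuousLinearMap.id ℝ (GrowthSpace V β) := by
  funext u v
  rw [germLeft, map_sub]
  rfl

theorem germX_eq_germLeft : germX W WW Y Y' = germLeft WW (fun t => evD β (Y t)) (evDDeriv Y Y') W
    fun _ => ContinuousLinearMap.id ℝ (GrowthSpace V β) := by
  funext u v
  rw [germLeft, map_sub]
  rfl

theorem isControlled_ev (hT : 0 ≤ T) (hα : 0 ≤ α) (hβ : ∀ k, 0 ≤ β k) (hW : IsHolder α T W)
    (hY : IsControlled α T W Y Y') :
    IsControlled α T W (fun t => ev β (Y t)) (evDeriv Y Y') := by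
  obtain ⟨R, hR⟩ := hY.holder.exists_bound hα
  obtain ⟨M, -, hM⟩ := exists_norm_ev_le (V := V) hβ R
  exact hY.comp_of_taylor (L := ev β) (L' := evD β) hT hα hW
    (fun t ht => mem_closedBall_zero_iff.2 (hR t ht)) (fun x hx y hy => (hM x hx y hy).1)
    (fun x hx y hy => (hM x hx y hy).2.2.1)

theorem isControlled_evD (hT : 0 ≤ T) (hα : 0 ≤ α) (hβ : ∀ k, 0 ≤ β k) (hW : IsHolder α T W)
    (hY : IsControlled α T W Y Y') :
    IsControlled α T W (fun t => evD β (Y t)) (evDDeriv Y Y') := by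
  obtain ⟨R, hR⟩ := hY.holder.exists_bound hα
  obtain ⟨M, -, hM⟩ := exists_norm_ev_le (V := V) hβ R
  have h := IsControlled.comp_of_taylor (G := V →L[ℝ] V) (L := evD β) (L' := evD2 β) hT hα hW hY
    (fun t ht => mem_closedBall_zero_iff.2 (hR t ht)) (fun x hx y hy => (hM x hx y hy).2.1)
    (fun x hx y hy => (hM x hx y hy).2.2.2.1)
  exact h

theorem isHolder_evD2 (hα : 0 ≤ α) (hβ : ∀ k, 0 ≤ β k) (hY : IsHolder α T Y) :
    IsHolder α T fun t => evD2 β (Y t) := by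
  obtain ⟨R, hR⟩ := hY.exists_bound hα
  obtain ⟨M, -, hM⟩ := exists_norm_ev_le (V := V) hβ R
  exact hY.comp_of_norm_le (L := evD2 β)
    (fun t ht => mem_closedBall_zero_iff.2 (hR t ht)) (fun x hx y hy => (hM x hx y hy).2.1)

/-- The product rule for F_t = δ_{Y_t}(W_t), both factors being controlled. -/
theorem isControlled_pathF (hT : 0 ≤ T) (hα : 0 ≤ α) (hβ : ∀ k, 0 ≤ β k) (hW : IsHolder α T W)
    (hY : IsControlled α T W Y Y') : IsControlled α T W (pathF W Y) (pathF' W Y Y') :=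
  IsControlled.clm_apply hT hα hW (isControlled_ev hT hα hβ hW hY) (isControlled_self hα hT hW)

theorem isControlled_fderiv (hT : 0 ≤ T) (hα : 0 ≤ α) (hβ : ∀ k, 0 ≤ β k) (hW : IsHolder α T W)
    (hY : IsControlled α T W Y Y') : IsControlled α T W (fun t => fderiv ℝ (W t) (Y t))
      (fun t => evD β (Y t) + (fderiv ℝ (fderiv ℝ (W t)) (Y t)).comp (Y' t)) :=
  IsControlled.clm_apply hT hα hW (isControlled_evD hT hα hβ hW hY) (isControlled_self hα hT hW)

theorem isControlled_pathH (hT : 0 ≤ T) (hα : 0 ≤ α) (hβ : ∀ k, 0 ≤ β k) (hW : IsHolder α T W)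
    (hY : IsControlled α T W Y Y') (hZ : IsControlled α T W Z Z') :
    IsControlled α T W (pathH W Y Z) (pathH' W Y Y' Z Z') := by
  have h := IsControlled.clm_apply hT hα hW (hZ.clm_comp (ContinuousLinearMap.compL ℝ V V K))
    (isControlled_fderiv hT hα hβ hW hY)
  have e : pathH' W Y Y' Z Z' = _ := funext fun t => add_comm _ _
  rw [e]
  exact h

theorem isIntegralPath_pathG (hT : 0 ≤ T) (hα : 1 / 3 < α) (hβ : ∀ k, 0 ≤ β k)
    (hW : IsRoughPath α T W WW) (hY : IsControlled α T W Y Y') :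
    IsIntegralPath T (germG W WW Y Y') (pathG W WW Y Y') ∧
      HasOrder T (3 * α) fun s _ t => pathG W WW Y Y' t - pathG W WW Y Y' s
        - germG W WW Y Y' s t := by
  have hα0 : 0 ≤ α := by linarith
  have h := exists_integralPath_germLeft hα hW
    (isControlled_ev hT hα0 hβ hW.holder hY) (isControlled_self hα0 hT hW.holder)
  rw [← germG_eq_germLeft] at h
  exact isIntegralPath_germInt_zero hT h

theorem isIntegralPath_pathX (hT : 0 ≤ T) (hα : 1 / 3 < α) (hβ : ∀ k, 0 ≤ β k)
    (hW : IsRoughPath α T W WW) (hY : IsControlled α T W Y Y') :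
    IsIntegralPath T (germX W WW Y Y') (pathX W WW Y Y') ∧
      HasOrder T (3 * α) fun s _ t => pathX W WW Y Y' t - pathX W WW Y Y' s
        - germX W WW Y Y' s t := by
  have hα0 : 0 ≤ α := by linarith
  have h := exists_integralPath_germLeft hα hW
    (isControlled_evD hT hα0 hβ hW.holder hY) (isControlled_self hα0 hT hW.holder)
  rw [← germX_eq_germLeft] at h
  exact isIntegralPath_germInt_zero hT h

theorem isControlled_pathG (hT : 0 ≤ T) (hα : 1 / 3 < α) (hβ : ∀ k, 0 ≤ β k)
    (hW : IsRoughPath α T W WW) (hY : IsControlled α T W Y Y') :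
    IsControlled α T W (pathG W WW Y Y') (pathG' β Y) := by
  have hα0 : 0 ≤ α := by linarith
  have h := (isIntegralPath_pathG hT hα hβ hW hY).2
  rw [germG_eq_germLeft] at h
  exact isControlled_integral hT hα0 hW (isControlled_ev hT hα0 hβ hW.holder hY)
    (isControlled_self hα0 hT hW.holder) h

theorem isControlled_pathX (hT : 0 ≤ T) (hα : 1 / 3 < α) (hβ : ∀ k, 0 ≤ β k)
    (hW : IsRoughPath α T W WW) (hY : IsControlled α T W Y Y') :
    IsControlled α T W (pathX W WW Y Y') (pathX' β Y) := by
  have hα0 : 0 ≤ α := by linarith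
  have h := (isIntegralPath_pathX hT hα hβ hW hY).2
  rw [germX_eq_germLeft] at h
  exact isControlled_integral hT hα0 hW (isControlled_evD hT hα0 hβ hW.holder hY)
    (isControlled_self hα0 hT hW.holder) h

/-- Hölder regularity without a Gubinelli derivative suffices, because this integrand is paired with
a 2α-Hölder compensator. -/
theorem isHolder_pathA (hα : 0 ≤ α) (hβ : ∀ k, 0 ≤ β k) (hW : IsHolder α T W)
    (hY : IsHolder α T Y) (hZ : IsHolder α T Z) : IsHolder α T (pathA W Y Z) := by
  have h1 : IsHolder α T fun t => fderiv ℝ (fderiv ℝ (W t)) (Y t) :=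
    (isHolder_evD2 hα hβ hY).clm_apply hα hW
  have h2 := IsHolder.clm_comp (F := (V →L[ℝ] V) →L[ℝ] V →L[ℝ] K) hZ
    (ContinuousLinearMap.compL ℝ V V K)
  exact (IsHolder.comp hα h2 h1).plift

theorem pathA_ptmul (t : ℝ) (x y : V) :
    pathA W Y Z t (ptmul x y) = Z t (fderiv ℝ (fderiv ℝ (W t)) (Y t) x y) :=
  plift_ptmul _ x y

theorem pathA_ptmul_comm (t : ℝ) (x y : V) :
    pathA W Y Z t (ptmul x y) = pathA W Y Z t (ptmul y x) := by
  have h : IsSymmSndFDerivAt ℝ (W t) (Y t) := (W t).contDiff.contDiffAt.isSymmSndFDerivAt (by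
    rw [minSmoothness_of_isRCLikeNormedField]; norm_num)
  rw [pathA_ptmul, pathA_ptmul, h x y]

/-- The second-order expansion of `W(t, Y_t)`. -/
theorem hasOrder_pathF_taylor (hα : 0 ≤ α) (hβ : ∀ k, 0 ≤ β k)
    (hW : IsHolder α T W) (hY : IsHolder α T Y) :
    HasOrder T (3 * α) fun s _ t => pathF W Y t - pathF W Y s - ev β (Y s) (W t - W s)
      - fderiv ℝ (W s) (Y s) (Y t - Y s) - evD β (Y s) (W t - W s) (Y t - Y s)
      - (1 / 2 : ℝ) • fderiv ℝ (fderiv ℝ (W s)) (Y s) (Y t - Y s) (Y t - Y s) := by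
  obtain ⟨R, hR⟩ := hY.exists_bound hα
  obtain ⟨M, -, hM⟩ := exists_norm_ev_le (V := V) hβ R
  have hYY := hY.hasOrder.mul_of_norm_le hY.hasOrder hα hα 1
    (h := fun s _ t => ‖Y t - Y s‖ * ‖Y t - Y s‖) (fun s u t => by simp)
  have hYYY := hY.hasOrder.mul_of_norm_le hYY hα (by linarith) 1
    (h := fun s _ t => ‖Y t - Y s‖ * (‖Y t - Y s‖ * ‖Y t - Y s‖)) (fun s u t => by simp)
  -- Expand the field at the later time t around Y_s. Replacing W_t by W_s then produces the cross
  -- term of order 2α in the linear part and, in the quadratic part, only the order 3α error `h2`.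
  have h1 : HasOrder T (3 * α) fun s _ t => W t (Y t) - W t (Y s)
      - fderiv ℝ (W t) (Y s) (Y t - Y s)
      - (1 / 2 : ℝ) • fderiv ℝ (fderiv ℝ (W t)) (Y s) (Y t - Y s) (Y t - Y s) := by
    have h := (((hW.hasOrder_zero_right hα).mul_of_norm_le hYYY le_rfl (by linarith) 1
      (h := fun s _ t => ‖W t‖ * (‖Y t - Y s‖ * (‖Y t - Y s‖ * ‖Y t - Y s‖)))
      (fun s u t => by simp)).of_eq (show _ = 3 * α by ring))
    refine h.of_norm_le M fun s u t hs hsu hut ht => ?_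
    refine ((hM _ (mem_closedBall_zero_iff.2 (hR s ⟨hs, by linarith⟩)) _
      (mem_closedBall_zero_iff.2 (hR t ⟨by linarith, ht⟩))).2.2.2.2 (W t)).trans (le_of_eq ?_)
    rw [Real.norm_of_nonneg (by positivity), mul_assoc]
  have h2 : HasOrder T (3 * α) fun s _ t =>
      evD2 β (Y s) (W t - W s) (Y t - Y s) (Y t - Y s) :=
    ((((((isHolder_evD2 hα hβ hY).hasOrder_zero hα).clm_apply hW.hasOrder le_rfl hα).clm_apply
      hY.hasOrder (by linarith) hα).clm_apply hY.hasOrder (by linarith) hα)).of_eq (by ring)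
  refine (h1.add (h2.const_smul (1 / 2))).congr fun s u t _ _ _ _ => ?_
  have e0 : ev β (Y s) (W t - W s) = W t (Y s) - W s (Y s) := map_sub (ev β (Y s)) _ _
  have e1 : evD β (Y s) (W t - W s) = fderiv ℝ (W t) (Y s) - fderiv ℝ (W s) (Y s) :=
    map_sub (evD β (Y s)) _ _
  have e2 : evD2 β (Y s) (W t - W s)
      = fderiv ℝ (fderiv ℝ (W t)) (Y s) - fderiv ℝ (fderiv ℝ (W s)) (Y s) :=
    map_sub (evD2 β (Y s)) _ _
  rw [e0, e1, e2]
  simp only [pathF, sub_apply]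
  module

theorem compYX_eq_compLeft : compYX W WW Y Y' = compLeft WW (fun t => evalOp V V (Y t))
    (fun t => (evalOp V V).comp (Y' t)) (pathX W WW Y Y') (pathX' β Y) :=
  compRight_eq_compLeft

/-- The second-level terms in the germs of the Itô formula cancel. -/
theorem second_level_cancel (t : ℝ)
    (ξ : ProjTensor (GrowthSpace V β) (GrowthSpace V β)) :
    plift (bil (Z' t) (pathF' W Y Y' t)) ξ - Z t (plift (evDeriv Y Y' t) ξ)
      - plift (bil (Z' t) (pathG' β Y t)) ξ - plift (bil (pathH' W Y Y' Z Z' t) (Y' t)) ξ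
      + pathA W Y Z t (plift (bil ((ptmulL V V).comp (Y' t)) (Y' t)) ξ)
      + Z t (plift (bil (pathX' β Y t) (Y' t)) ξ)
      + Z t (plift (bil ((evalOp V V).comp (Y' t)) (pathX' β Y t)) ξ) = 0 := by
  have h : plift (bil (Z' t) (pathF' W Y Y' t)) - (Z t).comp (plift (evDeriv Y Y' t))
      - plift (bil (Z' t) (pathG' β Y t)) - plift (bil (pathH' W Y Y' Z Z' t) (Y' t))
      + (pathA W Y Z t).comp (plift (bil ((ptmulL V V).comp (Y' t)) (Y' t)))
      + (Z t).comp (plift (bil (pathX' β Y t) (Y' t)))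
      + (Z t).comp (plift (bil ((evalOp V V).comp (Y' t)) (pathX' β Y t))) = 0 := by
    -- On φ ⊗ ψ everything pairs off: the terms with Z'_t(φ) between F' and G', H'; those with D²W
    -- between H' and ⟨Y⟩; those with Dφ and Dψ against ⟪X, Y⟫ and ⟪Y, X⟫.
    refine projTensor_ext fun φ ψ => ?_
    simp only [add_apply, sub_apply, ContinuousLinearMap.comp_apply, plift_ptmul, bil_apply,
      ptmulL_apply, pathA_ptmul, zero_apply]
    have e1 : pathF' W Y Y' t ψ = ev β (Y t) ψ + fderiv ℝ (W t) (Y t) (Y' t ψ) := rfl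
    have e2 : evDeriv Y Y' t φ ψ = evD β (Y t) ψ (Y' t φ) := rfl
    have e3 : pathG' β Y t ψ = ev β (Y t) ψ := rfl
    have e4 : pathH' W Y Y' Z Z' t φ (Y' t ψ) = Z' t φ (fderiv ℝ (W t) (Y t) (Y' t ψ))
      + Z t (evD β (Y t) φ (Y' t ψ) + fderiv ℝ (fderiv ℝ (W t)) (Y t) (Y' t φ) (Y' t ψ)) := rfl
    have e5 : pathX' β Y t φ (Y' t ψ) = evD β (Y t) φ (Y' t ψ) := rfl
    have e6 : evalOp V V (Y' t φ) (pathX' β Y t ψ) = evD β (Y t) ψ (Y' t φ) := rfl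
    rw [e1, e2, e3, e4, e5, e6]
    simp only [map_add]
    abel
  exact DFunLike.congr_fun h ξ

/-- The germs on the two sides of the Itô formula agree up to order `3α`. -/
theorem hasOrder_ito (hT : 0 ≤ T) (hα : 1 / 3 < α) (hβ : ∀ k, 0 ≤ β k)
    (hW : IsRoughPath α T W WW) (hY : IsControlled α T W Y Y') (hZ : IsControlled α T W Z Z') :
    HasOrder T (3 * α) fun s _ t =>
      germLeft WW Z Z' (pathF W Y) (pathF' W Y Y') s t
        - germLeft WW Z Z' (pathG W WW Y Y') (pathG' β Y) s t
        - germLeft WW (pathH W Y Z) (pathH' W Y Y' Z Z') Y Y' s t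
        - (1 / 2 : ℝ) • (youngGerm (pathA W Y Z) (compTensor WW Y Y') s t
          + youngGerm Z (compXY W WW Y Y' + compYX W WW Y Y') s t) := by
  have hα0 : 0 ≤ α := by linarith
  have hX := isControlled_pathX hT hα hβ hW hY
  have hZ0 := hZ.holder.hasOrder_zero hα0
  have hA0 := (isHolder_pathA hα0 hβ hW.holder hY.holder hZ.holder).hasOrder_zero hα0
  have h1 := (hZ0.clm_apply (isIntegralPath_pathG hT hα hβ hW hY).2 le_rfl (by linarith)).of_eq
    (zero_add _)
  have h2 := (hA0.clm_apply (hasOrder_compLeft_sub hα hW (hY.clm_comp (ptmulL V V)) hY) le_rfl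
    (by linarith)).of_eq (zero_add _)
  have h3 := (hZ0.clm_apply (hasOrder_compLeft_sub hα hW hX hY) le_rfl
    (by linarith)).of_eq (zero_add _)
  have h4 := (hZ0.clm_apply (hasOrder_compLeft_sub hα hW (hY.clm_comp (evalOp V V)) hX) le_rfl
    (by linarith)).of_eq (zero_add _)
  have h5 := (hZ0.clm_apply (hX.hasOrder_remainder.clm_apply hY.holder.hasOrder (by linarith) hα0)
    le_rfl (by linarith)).of_eq (show _ = 3 * α by ring)
  have h6 := (hZ0.clm_apply (hasOrder_pathF_taylor hα0 hβ hW.holder hY.holder) le_rfl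
    (by linarith)).of_eq (zero_add _)
  -- Both mixed compensators have leading product X_{s,t} Y_{s,t}, so half their sum contains it
  -- once; `h5` replaces X_{s,t} by DW_{s,t}(Y_s), giving the cross term of the Taylor expansion.
  have hhalf := ((h2.add h3).add h4).const_smul (1 / 2)
  refine (((h6.sub h1).sub hhalf).sub h5).congr fun s u t _ _ _ _ => ?_
  have hc := second_level_cancel (W := W) (Y := Y) (Y' := Y') (Z := Z) (Z' := Z') s (WW s t)
  have eH : pathH W Y Z s (Y t - Y s) = Z s (fderiv ℝ (W s) (Y s) (Y t - Y s)) := rfl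
  have eG : germG W WW Y Y' s t = ev β (Y s) (W t - W s) + plift (evDeriv Y Y' s) (WW s t) := by
    rw [map_sub]; rfl
  have eA : pathA W Y Z s ((ptmulL V V (Y t) - ptmulL V V (Y s)) (Y t - Y s))
      = Z s (fderiv ℝ (fderiv ℝ (W s)) (Y s) (Y t - Y s) (Y t - Y s)) := by
    rw [← map_sub, ptmulL_apply, pathA_ptmul]
  have eE : (evalOp V V (Y t) - evalOp V V (Y s)) (pathX W WW Y Y' t - pathX W WW Y Y' s)
      = (pathX W WW Y Y' t - pathX W WW Y Y' s) (Y t - Y s) := by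
    rw [← map_sub]; rfl
  have eX : pathX' β Y s (W t - W s) = evD β (Y s) (W t - W s) := rfl
  rw [compYX_eq_compLeft, compXY, compTensor_eq_compLeft]
  simp only [germLeft, youngGerm, Pi.add_apply]
  rw [eH, eG, eE, eX]
  generalize compLeft WW (fun t => ptmulL V V (Y t)) _ Y Y' s t = c1
  generalize compLeft WW (pathX W WW Y Y') _ Y Y' s t = c2
  generalize compLeft WW (fun t => evalOp V V (Y t)) _ _ _ s t = c3
  rw [map_sub (pathA W Y Z s) c1, map_sub (pathA W Y Z s) _ (_ • _), eA]
  simp only [map_add, map_sub, map_smul, sub_apply] at hc ⊢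
  -- What separates the two sides is exactly the second-level combination shown to vanish.
  rw [← sub_eq_zero, ← hc]
  module

/-- The defect of ⟨Y⟩ is Y_{u,t} ⊗ Y_{s,u} - Y_{s,u} ⊗ Y_{u,t}, on which the symmetric operator Z
D²W vanishes. -/
theorem exists_integralPath_compTensor (hT : 0 ≤ T) (hα : 1 / 3 < α) (hβ : ∀ k, 0 ≤ β k)
    (hW : IsRoughPath α T W WW) (hY : IsControlled α T W Y Y') (hZ : IsControlled α T W Z Z') :
    ∃ J, IsIntegralPath T (youngGerm (pathA W Y Z) (compTensor WW Y Y')) J := by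
  have hY2 := hY.clm_comp (ptmulL V V)
  rw [compTensor_eq_compLeft]
  refine exists_integralPath_youngGerm hα
    (isHolder_pathA (by linarith) hβ hW.holder hY.holder hZ.holder)
    (hasOrder_compLeft hT hα hW hY2 hY) fun s u t hs hsu hut ht => ?_
  rw [compLeft_sub_sub hα hW hY2 hY hs hsu hut ht, ← map_sub, ← map_sub, ptmulL_apply,
    ptmulL_apply, map_sub, pathA_ptmul_comm, sub_self]

/-- The defects of ⟪X, Y⟫ and ⟪Y, X⟫ are opposite, so their sum is additive. Either defect alone is
controlled only to order 2α, too little for sewing. -/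
theorem exists_integralPath_compXY_add_compYX (hT : 0 ≤ T) (hα : 1 / 3 < α) (hβ : ∀ k, 0 ≤ β k)
    (hW : IsRoughPath α T W WW) (hY : IsControlled α T W Y Y') (hZ : IsControlled α T W Z Z') :
    ∃ J, IsIntegralPath T (youngGerm Z (compXY W WW Y Y' + compYX W WW Y Y')) J := by
  have hX := isControlled_pathX hT hα hβ hW hY
  have hY2 := hY.clm_comp (evalOp V V)
  rw [compXY, compYX_eq_compLeft]
  refine exists_integralPath_youngGerm hα hZ.holder
    ((hasOrder_compLeft hT hα hW hX hY).add (hasOrder_compLeft hT hα hW hY2 hX))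
    fun s u t hs hsu hut ht => ?_
  have h1 := compLeft_sub_sub hα hW hX hY hs hsu hut ht
  have h2 := compLeft_sub_sub hα hW hY2 hX hs hsu hut ht
  rw [← map_sub, ← map_sub, evalOp_apply, evalOp_apply] at h2
  simp only [Pi.add_apply]
  rw [add_sub_add_comm, add_sub_add_comm, h1, h2]
  simp

end ItoFormula

end RoughIto

end

/-! ### Assembly of the Itô formula. -/

theorem theorem5p2
    {V K : Type*}
    [NormedAddCommGroup V] [NormedSpace ℝ V] [CompleteSpace V] [TopologicalSpace.SeparableSpace V]
    [NormedAddCommGroup K] [NormedSpace ℝ K] [CompleteSpace K] [TopologicalSpace.SeparableSpace K]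
    (T α : ℝ) (hT : 0 < T) (hα : 1 / 3 < α) (hα2 : α ≤ 1 / 2)
    (β : Fin (3 + 1) → ℝ) (hβ : ∀ k, 0 ≤ β k)
    (W : ℝ → RoughIto.GrowthSpace V β)
    (WW : ℝ → ℝ → RoughIto.ProjTensor (RoughIto.GrowthSpace V β) (RoughIto.GrowthSpace V β))
    (hW : RoughIto.IsRoughPath α T W WW)
    (Y : ℝ → V) (Y' : ℝ → RoughIto.GrowthSpace V β →L[ℝ] V)
    (hY : RoughIto.IsControlled α T W Y Y')
    (Z : ℝ → V →L[ℝ] K) (Z' : ℝ → RoughIto.GrowthSpace V β →L[ℝ] V →L[ℝ] K)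
    (hZ : RoughIto.IsControlled α T W Z Z') :
    -- the integrals `∫ W(dr, Y_r)` and `∫ DW(dr, Y_r)` exist
    (∀ s t, 0 ≤ s → s ≤ t → t ≤ T →
      RoughIto.RiemannLimExists (RoughIto.germG W WW Y Y') s t ∧
      RoughIto.RiemannLimExists (RoughIto.germX W WW Y Y') s t) ∧
    -- `F = W(·, Y)`, `G = ∫ W(dr, Y_r)`, `X = ∫ DW(dr, Y_r)` and `H = Z DW(·, Y)` are controlled
    RoughIto.IsControlled α T W (RoughIto.pathF W Y) (RoughIto.pathF' W Y Y') ∧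
    RoughIto.IsControlled α T W (RoughIto.pathG W WW Y Y') (RoughIto.pathG' β Y) ∧
    RoughIto.IsControlled α T W (RoughIto.pathX W WW Y Y') (RoughIto.pathX' β Y) ∧
    RoughIto.IsControlled α T W (RoughIto.pathH W Y Z) (RoughIto.pathH' W Y Y' Z Z') ∧
    -- the integrals in the compensators exist
    (∀ a s t, 0 ≤ a → a ≤ T → 0 ≤ s → s ≤ t → t ≤ T →
      RoughIto.RiemannLimExists (RoughIto.compTensorGerm WW Y Y' a) s t ∧
      RoughIto.RiemannLimExists
        (RoughIto.compLeftGerm WW (RoughIto.pathX W WW Y Y') (RoughIto.pathX' β Y) Y Y' a) s t ∧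
      RoughIto.RiemannLimExists
        (RoughIto.compRightGerm WW (RoughIto.pathX W WW Y Y') (RoughIto.pathX' β Y) Y Y' a) s t) ∧
    -- `⟨Y⟩`, `⟪X, Y⟫` and `⟪Y, X⟫` are `2α`-Hölder
    RoughIto.IsHolderTwo (2 * α) T (RoughIto.compTensor WW Y Y') ∧
    RoughIto.IsHolderTwo (2 * α) T (RoughIto.compXY W WW Y Y') ∧
    RoughIto.IsHolderTwo (2 * α) T (RoughIto.compYX W WW Y Y') ∧
    ∀ s t, 0 ≤ s → s ≤ t → t ≤ T →
      -- the integrals in the formula exist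
      RoughIto.RiemannLimExists
        (RoughIto.germLeft WW Z Z' (RoughIto.pathF W Y) (RoughIto.pathF' W Y Y')) s t ∧
      RoughIto.RiemannLimExists
        (RoughIto.germLeft WW Z Z' (RoughIto.pathG W WW Y Y') (RoughIto.pathG' β Y)) s t ∧
      RoughIto.RiemannLimExists
        (RoughIto.germLeft WW (RoughIto.pathH W Y Z) (RoughIto.pathH' W Y Y' Z Z') Y Y') s t ∧
      RoughIto.RiemannLimExists
        (RoughIto.youngGerm (RoughIto.pathA W Y Z) (RoughIto.compTensor WW Y Y')) s t ∧
      RoughIto.RiemannLimExists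
        (RoughIto.youngGerm Z (RoughIto.compXY W WW Y Y' + RoughIto.compYX W WW Y Y')) s t ∧
      -- the formula, with the integral against `⟪X, Y⟫ + ⟪Y, X⟫`
      RoughIto.germInt
          (RoughIto.germLeft WW Z Z' (RoughIto.pathF W Y) (RoughIto.pathF' W Y Y')) s t
        = RoughIto.germInt
            (RoughIto.germLeft WW Z Z' (RoughIto.pathG W WW Y Y') (RoughIto.pathG' β Y)) s t
          + RoughIto.germInt
            (RoughIto.germLeft WW (RoughIto.pathH W Y Z) (RoughIto.pathH' W Y Y' Z Z') Y Y') s t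
          + (1 / 2 : ℝ) •
            (RoughIto.germInt
                (RoughIto.youngGerm (RoughIto.pathA W Y Z) (RoughIto.compTensor WW Y Y')) s t
              + RoughIto.germInt
                (RoughIto.youngGerm Z
                  (RoughIto.compXY W WW Y Y' + RoughIto.compYX W WW Y Y')) s t) ∧
      -- the integrals against `⟪X, Y⟫` and `⟪Y, X⟫` exist together, and then the formula splits
      (RoughIto.RiemannLimExists (RoughIto.youngGerm Z (RoughIto.compXY W WW Y Y')) s t ↔
        RoughIto.RiemannLimExists (RoughIto.youngGerm Z (RoughIto.compYX W WW Y Y')) s t) ∧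
      (RoughIto.RiemannLimExists (RoughIto.youngGerm Z (RoughIto.compXY W WW Y Y')) s t →
        RoughIto.germInt
            (RoughIto.germLeft WW Z Z' (RoughIto.pathF W Y) (RoughIto.pathF' W Y Y')) s t
          = RoughIto.germInt
              (RoughIto.germLeft WW Z Z' (RoughIto.pathG W WW Y Y') (RoughIto.pathG' β Y)) s t
            + RoughIto.germInt
              (RoughIto.germLeft WW (RoughIto.pathH W Y Z) (RoughIto.pathH' W Y Y' Z Z') Y Y') s t
            + (1 / 2 : ℝ) •
              (RoughIto.germInt
                  (RoughIto.youngGerm (RoughIto.pathA W Y Z) (RoughIto.compTensor WW Y Y')) s t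
                + RoughIto.germInt (RoughIto.youngGerm Z (RoughIto.compXY W WW Y Y')) s t
                + RoughIto.germInt (RoughIto.youngGerm Z (RoughIto.compYX W WW Y Y')) s t)) := by
  have hT0 : 0 ≤ T := hT.le
  have hα0 : 0 ≤ α := by linarith
  have hG := RoughIto.isIntegralPath_pathG hT0 hα hβ hW hY
  have hX := RoughIto.isIntegralPath_pathX hT0 hα hβ hW hY
  have cF := RoughIto.isControlled_pathF hT0 hα0 hβ hW.holder hY
  have cG := RoughIto.isControlled_pathG hT0 hα hβ hW hY
  have cX := RoughIto.isControlled_pathX hT0 hα hβ hW hY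
  have cH := RoughIto.isControlled_pathH hT0 hα0 hβ hW.holder hY hZ
  have cYt := hY.clm_comp (RoughIto.ptmulL V V)
  have cYe := RoughIto.IsControlled.clm_comp (K₂ := (V →L[ℝ] V) →L[ℝ] V) hY (RoughIto.evalOp V V)
  refine ⟨fun s t hs hst ht => ⟨⟨_, hG.1 s t hs hst ht⟩, ⟨_, hX.1 s t hs hst ht⟩⟩, cF, cG, cX, cH,
    fun a s t _ _ hs hst ht => ⟨?_, ?_, ?_⟩, ?_, ?_, ?_, fun s t hs hst ht => ?_⟩
  · rw [RoughIto.compTensorGerm_eq_compLeftGerm]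
    obtain ⟨J, hJ, -⟩ := RoughIto.exists_integralPath_germLeft hα hW cYt hY
    exact ⟨_, hJ.compLeftGerm a s t hs hst ht⟩
  · obtain ⟨J, hJ, -⟩ := RoughIto.exists_integralPath_germLeft hα hW cX hY
    exact ⟨_, hJ.compLeftGerm a s t hs hst ht⟩
  · rw [RoughIto.compRightGerm_eq_compLeftGerm]
    obtain ⟨J, hJ, -⟩ := RoughIto.exists_integralPath_germLeft hα hW cYe cX
    exact ⟨_, hJ.compLeftGerm a s t hs hst ht⟩
  · rw [RoughIto.compTensor_eq_compLeft]
    exact RoughIto.isHolderTwo_compLeft hT0 hα hW cYt hY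
  · exact RoughIto.isHolderTwo_compLeft hT0 hα hW cX hY
  · rw [RoughIto.compYX_eq_compLeft]
    exact RoughIto.isHolderTwo_compLeft hT0 hα hW cYe cX
  obtain ⟨JF, hF, -⟩ := RoughIto.exists_integralPath_germLeft hα hW hZ cF
  obtain ⟨JG, hG', -⟩ := RoughIto.exists_integralPath_germLeft hα hW hZ cG
  obtain ⟨JH, hH, -⟩ := RoughIto.exists_integralPath_germLeft hα hW cH hY
  obtain ⟨JA, hA⟩ := RoughIto.exists_integralPath_compTensor hT0 hα hβ hW hY hZ
  obtain ⟨JS, hS⟩ := RoughIto.exists_integralPath_compXY_add_compYX hT0 hα hβ hW hY hZ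
  replace hF := hF s t hs hst ht
  replace hG' := hG' s t hs hst ht
  replace hH := hH s t hs hst ht
  replace hA := hA s t hs hst ht
  replace hS := hS s t hs hst ht
  have hzero := (RoughIto.hasOrder_ito hT0 hα hβ hW hY hZ).isRiemannLim_zero (by linarith)
    hs ht
  -- The Riemann sums of the combined germ converge to the combined integrals, and also to 0 because
  -- that germ has order 3α > 1.
  have hlim := ((hF.sub hG').sub hH).sub ((hA.add hS).const_smul (c := 1 / 2) (by norm_num))
  have hformula := hlim.unique hst hzero
  rw [sub_sub, sub_sub, sub_eq_zero, ← add_assoc] at hformula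
  have hsum : ∀ u v, RoughIto.youngGerm Z (RoughIto.compXY W WW Y Y' + RoughIto.compYX W WW Y Y')
      u v = RoughIto.youngGerm Z (RoughIto.compXY W WW Y Y') u v
        + RoughIto.youngGerm Z (RoughIto.compYX W WW Y Y') u v := fun u v => map_add (Z u) _ _
  -- The integral against the sum always exists, so convergence for one summand gives it for the
  -- other by subtraction.
  have hYX : ∀ I, RoughIto.IsRiemannLim (RoughIto.youngGerm Z (RoughIto.compXY W WW Y Y')) s t I →
      RoughIto.IsRiemannLim (RoughIto.youngGerm Z (RoughIto.compYX W WW Y Y')) s t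
        (JS t - JS s - I) := fun I hI => by
    simpa only [hsum, add_sub_cancel_left] using hS.sub hI
  have hXY : ∀ I, RoughIto.IsRiemannLim (RoughIto.youngGerm Z (RoughIto.compYX W WW Y Y')) s t I →
      RoughIto.IsRiemannLim (RoughIto.youngGerm Z (RoughIto.compXY W WW Y Y')) s t
        (JS t - JS s - I) := fun I hI => by
    simpa only [hsum, add_sub_cancel_right] using hS.sub hI
  rw [hF.germInt_eq hst, hG'.germInt_eq hst, hH.germInt_eq hst, hA.germInt_eq hst,
    hS.germInt_eq hst]
  refine ⟨⟨_, hF⟩, ⟨_, hG'⟩, ⟨_, hH⟩, ⟨_, hA⟩, ⟨_, hS⟩, hformula,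
    ⟨fun ⟨I, hI⟩ => ⟨_, hYX I hI⟩, fun ⟨I, hI⟩ => ⟨_, hXY I hI⟩⟩, fun ⟨I, hI⟩ => ?_⟩
  rw [hI.germInt_eq hst, (hYX I hI).germInt_eq hst, hformula]
  congr 2
  abel
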